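/- **Setting.** Let $U$ be an open subset of $\mathbb{C}^2$ with coordinates $(z^1,z^2)$ (a holomorphic coordinate neighbourhood of a complex two-dimensional Kähler manifold), carrying a locally symmetric Kähler metric $g_{k\bar l}$; thus locally $g_{k\bar l}=\partial_k\partial_{\bar l}\Phi$ with a real smooth Kähler potential $\Phi$, and $\nabla R=0$. Put $g_{\bar k l}=g_{l\bar k}$, let $(g^{\bar k l})$ be the inverse matrix of $(g_{\bar k l})$, $g^{k\bar l}=g^{\bar l k}$, and $D^k=g^{k\bar l}\partial_{\bar l}$, $D^{\bar k}=g^{\bar k l}\partial_l$ (summation over repeated indices). The curvature is $R(\partial_A,\partial_B)\partial_C=R_{ABC}{}^{D}\partial_D$ with $R(X,Y)=\nabla_X\nabla_Y-\nabla_Y\nabla_X-\nabla_{[X,Y]}$ and $R_{ABCD}=g_{DE}R_{ABC}{}^{E}$, where $A,B,C,D,E\in\{1,2,\bar1,\bar2\}$; set $R_{\bar i}{}^{\bar k\bar l}{}_{\bar c}=g^{\bar k p}g^{\bar l q}R_{\bar i p q\bar c}$. Let $\ast$ be a star product on $U$, $f\ast h=\sum_k C_k(f,h)\hbar^k$: $\hbar$-bilinear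 and associative, with $1$ as unit, with bidifferential operators $C_k$, with $C_0(f,h)=fh$ and $C_1(f,h)-C_1(h,f)=\{f,h\}:=g^{\bar k l}(\partial_{\bar k}f\,\partial_l h-\partial_l f\,\partial_{\bar k}h)$. Assume that it has separation of variables ($a\ast f=af$ for holomorphic $a$ and $f\ast b=fb$ for antiholomorphic $b$, on every open subset of $U$), and that it is Karabegov's star product of the Kähler form, i.e. $f\ast\partial_{\bar l}\Phi=f\,\partial_{\bar l}\Phi+\hbar\,\partial_{\bar l}f$ for every local Kähler potential $\Phi$ and $l=1,2$. Suppose that $$f\ast h=\sum_{n=0}^{\infty}\sum_{i,j=1}^{n+1}T^n_{ij}\,\bigl\{(D^1)^{n-i+1}(D^2)^{i-1}f\bigr\}\bigl\{(D^{\bar1})^{n-j+1}(D^{\bar2})^{j-1}h\bigr\}$$ with smooth coefficients $T^n_{ij}$ on $U$ with values in $\mathbb{C}[[\hbar]]$, where for each $k$ only finitely many $n$ contribute to the coefficient of $\hbar^k$; put $T^n_{ij}=0$ if $n<0$ or if $i$ or $j$ lies outside $\{1,\dots,n+1\}$. **Theorem.** For every $n\ge 0$ and at every point of $U$, the matrix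 $T_n=(T^n_{ij})\in M_{n+1}(\mathbb{C}[[\hbar]])$ satisfies $$T_nY_n=\hbar\,C'_n\qquad\text{and, equivalently,}\qquad Y_n^{\dagger}T_n=\hbar\,C_n'^{\dagger},$$ where $\dagger$ is the conjugate transpose (with $\hbar$ real), $$C'_n=\Bigl(\sum_{k,l=1}^{2}(-1)^{\delta_{k2}}\,g_{\bar k l}\,T^{n-1}_{i-\delta_{2l},\,j-\delta_{2k}}\Bigr)_{1\le i,j\le n+1},$$ and $Y_n=(Y^n_{ij})\in M_{n+1}(\mathbb{C}[[\hbar]])$ is the pentadiagonal matrix with $$\begin{aligned} Y^n_{j-2,j}&=-\tbinom{n-j+3}{2}\hbar R_{\bar2}{}^{\bar1\bar1}{}_{\bar2},\\ Y^n_{j-1,j}&=-(n-j+2)(j-2)\,\hbar R_{\bar2}{}^{\bar2\bar1}{}_{\bar2},\\ Y^n_{j,j}&=n-2j+2+\tbinom{n-j+1}{2}\hbar R_{\bar1}{}^{\bar1\bar1}{}_{\bar1}-\tbinom{j-1}{2}\hbar R_{\bar2}{}^{\bar2\bar2}{}_{\bar2},\\ Y^n_{j+1,j}&=j(n-j)\,\hbar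 R_{\bar1}{}^{\bar2\bar1}{}_{\bar1},\\ Y^n_{j+2,j}&=\tbinom{j+1}{2}\hbar R_{\bar1}{}^{\bar2\bar2}{}_{\bar1},\\ Y^n_{j,k}&=0\quad(|j-k|>2). \end{aligned}$$ -/

import Mathlib

open scoped ContDiff PowerSeries ComplexOrder

noncomputable section

namespace KahlerStar

/-! ### Wirtinger calculus on `ℂ²` -/

/-- Points of `ℂ²`, i.e. values of the holomorphic coordinates `(z¹, z²)`. -/
abbrev C2 : Type := Fin 2 → ℂ

/-- The index set `{1, 2, 1̄, 2̄}`: `Sum.inl k` is the holomorphic index and `Sum.inr k` is the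
antiholomorphic one (with `k = 0, 1` standing for the coordinate numbers 1, 2). -/
abbrev Idx : Type := Fin 2 ⊕ Fin 2

/-- `∂_k = ∂/∂z^k = (∂/∂x^k - i ∂/∂y^k) / 2`. -/
def dz (k : Fin 2) (f : C2 → ℂ) : C2 → ℂ := fun p =>
  (1 / 2 : ℂ) * (fderiv ℝ f p (Pi.single k 1) - Complex.I * fderiv ℝ f p (Pi.single k Complex.I))

/-- `∂_k̄ = ∂/∂z̄^k = (∂/∂x^k + i ∂/∂y^k) / 2`. -/
def dzbar (k : Fin 2) (f : C2 → ℂ) : C2 → ℂ := fun p =>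
  (1 / 2 : ℂ) * (fderiv ℝ f p (Pi.single k 1) + Complex.I * fderiv ℝ f p (Pi.single k Complex.I))

/-- `∂_A` for `A ∈ {1, 2, 1̄, 2̄}`. -/
def pd (A : Idx) : (C2 → ℂ) → C2 → ℂ := Sum.elim dz dzbar A

/-- `f` restricts to an element of `C^∞(V)` (complex valued, smooth in the real sense). -/
def SmoothOn (V : Set C2) (f : C2 → ℂ) : Prop := ContDiffOn ℝ ∞ f V

/-! ### Kähler geometry in holomorphic coordinates

The metric is given by the matrix function `g p k l = g_{k l̄}(p)`. -/

/-- `Φ` is a (real) Kähler potential of `g` on `V`: `g_{k l̄} = ∂_k ∂_l̄ Φ`. -/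
structure IsPotentialOn (V : Set C2) (g : C2 → Matrix (Fin 2) (Fin 2) ℂ) (Φ : C2 → ℝ) : Prop where
  smooth : ContDiffOn ℝ ∞ Φ V
  eq : ∀ p ∈ V, ∀ k l : Fin 2, g p k l = dz k (dzbar l fun q => (Φ q : ℂ)) p

/-- `g` is a Kähler metric on `U`: a smooth field of positive definite Hermitian matrices which
locally has a Kähler potential. -/
structure IsKahlerOn (U : Set C2) (g : C2 → Matrix (Fin 2) (Fin 2) ℂ) : Prop where
  smooth : ∀ k l, SmoothOn U fun p => g p k l
  posDef : ∀ p ∈ U, (g p).PosDef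
  potential : ∀ p ∈ U, ∃ V : Set C2, IsOpen V ∧ p ∈ V ∧ V ⊆ U ∧ ∃ Φ : C2 → ℝ, IsPotentialOn V g Φ

/-- The full metric `g_{AB}`: `g_{kl} = g_{k̄l̄} = 0`, `g_{k l̄} = g_{l̄ k}`. -/
def gLow (g : C2 → Matrix (Fin 2) (Fin 2) ℂ) (p : C2) : Matrix Idx Idx ℂ :=
  Matrix.fromBlocks 0 (g p) (g p).transpose 0

/-- The inverse metric `g^{AB}`. -/
def gUp (g : C2 → Matrix (Fin 2) (Fin 2) ℂ) (p : C2) : Matrix Idx Idx ℂ := (gLow g p)⁻¹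

/-- Christoffel symbols `Γ^A_{BC} = ½ g^{AD} (∂_B g_{DC} + ∂_C g_{DB} - ∂_D g_{BC})`. -/
def christoffel (g : C2 → Matrix (Fin 2) (Fin 2) ℂ) (A B C : Idx) : C2 → ℂ := fun p =>
  (1 / 2 : ℂ) * ∑ D : Idx, gUp g p A D *
    (pd B (fun q => gLow g q D C) p + pd C (fun q => gLow g q D B) p
      - pd D (fun q => gLow g q B C) p)

/-- The curvature components `R_{ABC}^D`, where `R(∂_A, ∂_B) ∂_C = R_{ABC}^D ∂_D`. -/
def riem (g : C2 → Matrix (Fin 2) (Fin 2) ℂ) (A B C D : Idx) : C2 → ℂ := fun p =>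
  pd A (christoffel g D B C) p - pd B (christoffel g D A C) p
    + ∑ E : Idx, (christoffel g E B C p * christoffel g D A E p
        - christoffel g E A C p * christoffel g D B E p)

/-- The components `∇_E R_{ABC}^D` of the covariant derivative of the curvature tensor. -/
def nablaRiem (g : C2 → Matrix (Fin 2) (Fin 2) ℂ) (E A B C D : Idx) : C2 → ℂ := fun p =>
  pd E (riem g A B C D) p
    + ∑ F : Idx, (christoffel g D E F p * riem g A B C F p
        - christoffel g F E A p * riem g F B C D p
        - christoffel g F E B p * riem g A F C D p
        - christoffel g F E C p * riem g A B F D p)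

/-- The metric is locally symmetric on `U`: `∇R = 0`. -/
def IsLocallySymmetricOn (U : Set C2) (g : C2 → Matrix (Fin 2) (Fin 2) ℂ) : Prop :=
  ∀ p ∈ U, ∀ A B C D E : Idx, nablaRiem g E A B C D p = 0

/-- `R_{ABCD} = g_{DE} R_{ABC}^E`. -/
def riemLow (g : C2 → Matrix (Fin 2) (Fin 2) ℂ) (A B C D : Idx) (p : C2) : ℂ :=
  ∑ E : Idx, gLow g p D E * riem g A B C E p

/-- `curv g i k l c p` is `R_{ī}^{k̄ l̄}_{c̄} = g^{k̄ p} g^{l̄ q} R_{ī p q c̄}` at the given point. -/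
def curv (g : C2 → Matrix (Fin 2) (Fin 2) ℂ) (i k l c : Fin 2) (p : C2) : ℂ :=
  ∑ r : Fin 2, ∑ s : Fin 2,
    gUp g p (Sum.inr k) (Sum.inl r) * gUp g p (Sum.inr l) (Sum.inl s)
      * riemLow g (Sum.inr i) (Sum.inl r) (Sum.inl s) (Sum.inr c) p

/-- `D^k = g^{k l̄} ∂_l̄`. -/
def Dop (g : C2 → Matrix (Fin 2) (Fin 2) ℂ) (k : Fin 2) (f : C2 → ℂ) : C2 → ℂ := fun p =>
  ∑ l : Fin 2, gUp g p (Sum.inl k) (Sum.inr l) * dzbar l f p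

/-- `D^k̄ = g^{k̄ l} ∂_l`. -/
def DopBar (g : C2 → Matrix (Fin 2) (Fin 2) ℂ) (k : Fin 2) (f : C2 → ℂ) : C2 → ℂ := fun p =>
  ∑ l : Fin 2, gUp g p (Sum.inr k) (Sum.inl l) * dz l f p

/-- The Poisson bracket `{f, h} = g^{k̄ l} (∂_k̄ f ∂_l h - ∂_l f ∂_k̄ h)`. -/
def poisson (g : C2 → Matrix (Fin 2) (Fin 2) ℂ) (f h : C2 → ℂ) : C2 → ℂ := fun p =>
  ∑ k : Fin 2, ∑ l : Fin 2, gUp g p (Sum.inr k) (Sum.inl l)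
    * (dzbar k f p * dz l h p - dz l f p * dzbar k h p)

/-! ### Star products -/

/-- `∂^I` for a multi-index `I` over `{1, 2, 1̄, 2̄}`. -/
def pdMulti (I : Idx → ℕ) (f : C2 → ℂ) : C2 → ℂ :=
  (dz 0)^[I (Sum.inl 0)] ((dz 1)^[I (Sum.inl 1)]
    ((dzbar 0)^[I (Sum.inr 0)] ((dzbar 1)^[I (Sum.inr 1)] f)))

/-- `B` is a bidifferential operator on `U` with smooth coefficients. It acts on smooth functions
on every open subset of `U`. -/
def IsBidiffOn (U : Set C2) (B : (C2 → ℂ) → (C2 → ℂ) → C2 → ℂ) : Prop :=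
  ∃ (S : Finset ((Idx → ℕ) × (Idx → ℕ))) (a : (Idx → ℕ) × (Idx → ℕ) → C2 → ℂ),
    (∀ x, SmoothOn U (a x)) ∧
    ∀ V : Set C2, IsOpen V → V ⊆ U → ∀ f h : C2 → ℂ, SmoothOn V f → SmoothOn V h →
      ∀ p ∈ V, B f h p = ∑ x ∈ S, a x p * pdMulti x.1 f p * pdMulti x.2 h p

/-- `F` restricts to an element of `C^∞(V)⟦ħ⟧`. -/
def FormalSmoothOn (V : Set C2) (F : (C2 → ℂ)⟦X⟧) : Prop :=
  ∀ k, SmoothOn V (PowerSeries.coeff k F)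

/-- Equality in `C^∞(V)⟦ħ⟧`. -/
def FormalEqOn (V : Set C2) (F G : (C2 → ℂ)⟦X⟧) : Prop :=
  ∀ k, Set.EqOn (PowerSeries.coeff k F) (PowerSeries.coeff k G) V

/-- The `ħ`-bilinear product `F ∗ G = ∑_k C_k(F, G) ħ^k` on formal power series of functions. -/
def starProd (C : ℕ → (C2 → ℂ) → (C2 → ℂ) → C2 → ℂ) (F G : (C2 → ℂ)⟦X⟧) : (C2 → ℂ)⟦X⟧ :=
  PowerSeries.mk fun m => ∑ x ∈ Finset.HasAntidiagonal.antidiagonal m,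
    ∑ y ∈ Finset.HasAntidiagonal.antidiagonal x.2,
      C x.1 (PowerSeries.coeff y.1 F) (PowerSeries.coeff y.2 G)

/-- `f ∗ h = ∑_k C_k(f, h) ħ^k` is a star product on `U`. -/
structure IsStarProductOn (U : Set C2) (g : C2 → Matrix (Fin 2) (Fin 2) ℂ)
    (C : ℕ → (C2 → ℂ) → (C2 → ℂ) → C2 → ℂ) : Prop where
  bidiff : ∀ k, IsBidiffOn U (C k)
  assoc : ∀ V : Set C2, IsOpen V → V ⊆ U → ∀ F G H : (C2 → ℂ)⟦X⟧,
    FormalSmoothOn V F → FormalSmoothOn V G → FormalSmoothOn V H →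
      FormalEqOn V (starProd C F (starProd C G H)) (starProd C (starProd C F G) H)
  zeroth : ∀ V : Set C2, IsOpen V → V ⊆ U → ∀ f h : C2 → ℂ, SmoothOn V f → SmoothOn V h →
    ∀ p ∈ V, C 0 f h p = f p * h p
  first : ∀ V : Set C2, IsOpen V → V ⊆ U → ∀ f h : C2 → ℂ, SmoothOn V f → SmoothOn V h →
    ∀ p ∈ V, C 1 f h p - C 1 h f p = poisson g f h p
  unit : ∀ V : Set C2, IsOpen V → V ⊆ U → ∀ F : (C2 → ℂ)⟦X⟧, FormalSmoothOn V F →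
    FormalEqOn V (starProd C F 1) F ∧ FormalEqOn V (starProd C 1 F) F

/-- Separation of variables: `a ∗ f = a f` for holomorphic `a` and `f ∗ b = f b` for
antiholomorphic `b`, on every open subset of `U`. -/
structure SeparatesVariablesOn (U : Set C2) (C : ℕ → (C2 → ℂ) → (C2 → ℂ) → C2 → ℂ) : Prop where
  holo : ∀ V : Set C2, IsOpen V → V ⊆ U → ∀ a f : C2 → ℂ, DifferentiableOn ℂ a V → SmoothOn V f →
    FormalEqOn V (starProd C (PowerSeries.C a) (PowerSeries.C f)) (PowerSeries.C (a * f))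
  antiholo : ∀ V : Set C2, IsOpen V → V ⊆ U → ∀ f b : C2 → ℂ, SmoothOn V f →
    DifferentiableOn ℂ (fun p => (starRingEnd ℂ) (b p)) V →
    FormalEqOn V (starProd C (PowerSeries.C f) (PowerSeries.C b)) (PowerSeries.C (f * b))

/-- Karabegov's normalization, which attaches the star product to the Kähler form itself: for
every local Kähler potential `Φ`, right star multiplication by `∂_l̄ Φ` is the operator
`∂_l̄ Φ + ħ ∂_l̄`. -/
def IsKarabegovNormalizedOn (U : Set C2) (g : C2 → Matrix (Fin 2) (Fin 2) ℂ)
    (C : ℕ → (C2 → ℂ) → (C2 → ℂ) → C2 → ℂ) : Prop :=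
  ∀ V : Set C2, IsOpen V → V ⊆ U → ∀ Φ : C2 → ℝ, IsPotentialOn V g Φ →
    ∀ f : C2 → ℂ, SmoothOn V f → ∀ l : Fin 2,
      FormalEqOn V
        (starProd C (PowerSeries.C f) (PowerSeries.C (dzbar l fun q => (Φ q : ℂ))))
        (PowerSeries.C ((dzbar l fun q => (Φ q : ℂ)) * f)
          + PowerSeries.X * PowerSeries.C (dzbar l f))

/-- The star product has the form
`f ∗ h = ∑_n ∑_{i,j=1}^{n+1} T^n_{ij} ((D¹)^{n-i+1} (D²)^{i-1} f) ((D^1̄)^{n-j+1} (D^2̄)^{j-1} h)`,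
with smooth coefficients `T n i j p = T^n_{ij}(p) ∈ ℂ⟦ħ⟧`, which are `0` by convention outside the
range `0 ≤ n`, `1 ≤ i, j ≤ n + 1`. The sum over `n` is `ħ`-adically convergent: only finitely many
`n` contribute to each power of `ħ`. -/
structure HasExpansionOn (U : Set C2) (g : C2 → Matrix (Fin 2) (Fin 2) ℂ)
    (C : ℕ → (C2 → ℂ) → (C2 → ℂ) → C2 → ℂ) (T : ℤ → ℤ → ℤ → C2 → ℂ⟦X⟧) : Prop where
  smooth : ∀ n i j k, SmoothOn U fun p => PowerSeries.coeff k (T n i j p)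
  outside : ∀ n i j : ℤ, ¬ (0 ≤ n ∧ 1 ≤ i ∧ i ≤ n + 1 ∧ 1 ≤ j ∧ j ≤ n + 1) →
    ∀ p ∈ U, T n i j p = 0
  expand : ∀ k : ℕ, ∃ N : ℕ,
    (∀ n : ℕ, N ≤ n → ∀ i j : ℤ, ∀ p ∈ U, PowerSeries.coeff k (T n i j p) = 0) ∧
    ∀ V : Set C2, IsOpen V → V ⊆ U → ∀ f h : C2 → ℂ, SmoothOn V f → SmoothOn V h → ∀ p ∈ V,
      C k f h p = ∑ n ∈ Finset.range N,
        ∑ i ∈ Finset.Icc 1 (n + 1), ∑ j ∈ Finset.Icc 1 (n + 1),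
          PowerSeries.coeff k (T n i j p)
            * ((Dop g 0)^[n + 1 - i] ((Dop g 1)^[i - 1] f)) p
            * ((DopBar g 0)^[n + 1 - j] ((DopBar g 1)^[j - 1] h)) p

/-! ### The matrices -/

/-- The matrix `T_n = (T^n_{ij})`, `1 ≤ i, j ≤ n + 1`, at the point `p`. -/
def TMat (T : ℤ → ℤ → ℤ → C2 → ℂ⟦X⟧) (n : ℕ) (p : C2) :
    Matrix (Fin (n + 1)) (Fin (n + 1)) ℂ⟦X⟧ :=
  Matrix.of fun i j => T n ((i : ℤ) + 1) ((j : ℤ) + 1) p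

/-- The matrix `C'_n` with entries
`∑_{k,l=1}^2 (-1)^{δ_{k2}} g_{k̄ l} T^{n-1}_{i - δ_{2l}, j - δ_{2k}}`. -/
def CMat (g : C2 → Matrix (Fin 2) (Fin 2) ℂ) (T : ℤ → ℤ → ℤ → C2 → ℂ⟦X⟧) (n : ℕ) (p : C2) :
    Matrix (Fin (n + 1)) (Fin (n + 1)) ℂ⟦X⟧ :=
  Matrix.of fun i j => ∑ k : Fin 2, ∑ l : Fin 2,
    PowerSeries.C ((if k = 1 then -1 else 1) * gLow g p (Sum.inr k) (Sum.inl l))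
      * T ((n : ℤ) - 1) ((i : ℤ) + 1 - if l = 1 then 1 else 0)
          ((j : ℤ) + 1 - if k = 1 then 1 else 0) p

/-- The entry `Y^n_{ij}` (rows and columns numbered from 1, `1 ≤ i, j ≤ n + 1`). -/
def yEntry (g : C2 → Matrix (Fin 2) (Fin 2) ℂ) (n : ℕ) (p : C2) (i j : ℕ) : ℂ⟦X⟧ :=
  if i + 2 = j then
    PowerSeries.X * PowerSeries.C (-((n + 3 - j).choose 2 : ℂ) * curv g 1 0 0 1 p)
  else if i + 1 = j then
    PowerSeries.X * PowerSeries.C (-(((n : ℂ) - j + 2) * ((j : ℂ) - 2)) * curv g 1 1 0 1 p)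
  else if i = j then
    PowerSeries.C ((n : ℂ) - 2 * j + 2)
      + PowerSeries.X * PowerSeries.C (((n + 1 - j).choose 2 : ℂ) * curv g 0 0 0 0 p
          - ((j - 1).choose 2 : ℂ) * curv g 1 1 1 1 p)
  else if i = j + 1 then
    PowerSeries.X * PowerSeries.C ((j : ℂ) * ((n : ℂ) - j) * curv g 0 1 0 0 p)
  else if i = j + 2 then
    PowerSeries.X * PowerSeries.C (((j + 1).choose 2 : ℂ) * curv g 0 1 1 0 p)
  else 0

/-- The pentadiagonal matrix `Y_n`. -/
def YMat (g : C2 → Matrix (Fin 2) (Fin 2) ℂ) (n : ℕ) (p : C2) :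
    Matrix (Fin (n + 1)) (Fin (n + 1)) ℂ⟦X⟧ :=
  Matrix.of fun i j => yEntry g n p ((i : ℕ) + 1) ((j : ℕ) + 1)

/-- The conjugate transpose over `ℂ⟦ħ⟧`, with `ħ` real. -/
def dagger {m : ℕ} (M : Matrix (Fin m) (Fin m) ℂ⟦X⟧) : Matrix (Fin m) (Fin m) ℂ⟦X⟧ :=
  M.transpose.map (PowerSeries.map (starRingEnd ℂ))

end KahlerStar

end

/-! Fix a point p and a local potential Φ. The functions u_k = ∂_kΦ and v_l = ∂_l̄Φ, shifted by
constants so as to vanish at p, satisfy D^k u_l = δ_kl and D^k̄ v_l = δ_kl. Divided-power monomials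
in u and v are therefore dual at p to the operators of the expansion, and testing the star product
on them reads off single rows and entries of T.

Since h ∗ ∂_l̄Φ = h ∂_l̄Φ + ħ ∂_l̄h, associativity f ∗ (h ∗ ∂_l̄Φ) = (f ∗ h) ∗ ∂_l̄Φ becomes f ∗ (h
∂_l̄Φ) + ħ f ∗ ∂_l̄h = ∂_l̄Φ (f ∗ h) + ħ ∂_l̄(f ∗ h) (`zeroth_mul_potential`, `succ_mul_potential`).
Take f a monomial of degree n in u and h one of degree n - 1 in v, and evaluate at p. The first term
is a multiple of an entry of T_n. In the second, exactly two of the n derivatives are left for a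
function ∂_l̄ ∂_b̄ Φ, and D^c̄ D^ā ∂_l̄ ∂_b̄ Φ is a curvature component (`DopBar_DopBar_eq_curv`).
On the right, f ∗ h vanishes at p, and ∂_l̄ = g_{k l̄} D^k lowers the degree of f by one, leaving
entries of T_{n-1}. The result is `SatisfiesRecursion`. The difference of its instances for the two
values of l, with the monomials chosen to share their leading entry of T_n, is one column of T_n Y_n
= ħ C'_n; curvature symmetries cancel the mixed terms (`mul_YMat`).

The second identity is the adjoint of the first once T_n is known to be Hermitian. The product (f,
h) ↦ conj(conj h ∗ conj f) is again associative, unital and normalized, with coefficients conj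
T^n_{ji}; both coefficient families solve the recursion with T_0 = 1, and the recursion has only one
such solution (`SatisfiesRecursion.unique`, `coeff_hermitian`). -/

noncomputable section

namespace KahlerStar

/-! ### Derivations of the smooth functions on an open set -/

/-- `D` acts as a derivation on the smooth functions on `V`. -/
structure IsDerivationOn (V : Set C2) (D : (C2 → ℂ) → C2 → ℂ) : Prop where
  smooth : ∀ {f}, SmoothOn V f → SmoothOn V (D f)
  congr : ∀ {f h}, Set.EqOn f h V → Set.EqOn (D f) (D h) V
  add : ∀ {f h}, SmoothOn V f → SmoothOn V h → Set.EqOn (D (f + h)) (D f + D h) V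
  mul : ∀ {f h}, SmoothOn V f → SmoothOn V h → Set.EqOn (D (f * h)) (D f * h + f * D h) V
  const : ∀ c : ℂ, Set.EqOn (D fun _ => c) 0 V

namespace SmoothOn

variable {V : Set C2} {f h : C2 → ℂ}

theorem const (c : ℂ) : SmoothOn V fun _ => c := contDiffOn_const

theorem zero : SmoothOn V 0 := const 0

theorem one : SmoothOn V 1 := const 1

theorem add (hf : SmoothOn V f) (hh : SmoothOn V h) : SmoothOn V (f + h) := ContDiffOn.add hf hh

theorem sub (hf : SmoothOn V f) (hh : SmoothOn V h) : SmoothOn V (f - h) := ContDiffOn.sub hf hh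

theorem mul (hf : SmoothOn V f) (hh : SmoothOn V h) : SmoothOn V (f * h) := ContDiffOn.mul hf hh

theorem pow (hf : SmoothOn V f) (n : ℕ) : SmoothOn V (f ^ n) := ContDiffOn.pow hf n

theorem smul (c : ℂ) (hf : SmoothOn V f) : SmoothOn V (c • f) := ContDiffOn.const_smul c hf

theorem congr (hf : SmoothOn V f) (e : Set.EqOn h f V) : SmoothOn V h := ContDiffOn.congr hf e

theorem mono {W : Set C2} (hf : SmoothOn V f) (e : W ⊆ V) : SmoothOn W f := ContDiffOn.mono hf e

theorem sum {ι : Type*} {s : Finset ι} {F : ι → C2 → ℂ} (hF : ∀ i ∈ s, SmoothOn V (F i)) :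
    SmoothOn V (∑ i ∈ s, F i) := by
  have := ContDiffOn.sum (𝕜 := ℝ) (n := ∞) (t := V) hF
  exact this.congr fun x _ => by simp

theorem conj (hf : SmoothOn V f) : SmoothOn V (star f) :=
  (Complex.conjCLE.contDiff (n := ∞)).comp_contDiffOn hf

theorem differentiableAt (hf : SmoothOn V f) (hV : IsOpen V) {p : C2} (hp : p ∈ V) :
    DifferentiableAt ℝ f p :=
  (ContDiffOn.contDiffAt hf (hV.mem_nhds hp)).differentiableAt (by simp)

end SmoothOn

namespace IsDerivationOn

variable {V : Set C2} {D : (C2 → ℂ) → C2 → ℂ}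

theorem zero (hD : IsDerivationOn V D) : Set.EqOn (D 0) 0 V := hD.const 0

theorem smul (hD : IsDerivationOn V D) (c : ℂ) {f : C2 → ℂ} (hf : SmoothOn V f) :
    Set.EqOn (D (c • f)) (c • D f) V := by
  intro p hp
  have h1 : c • f = (fun _ => c) * f := by ext; simp
  rw [h1, hD.mul (SmoothOn.const c) hf hp]
  simp [hD.const c hp]

theorem sum (hD : IsDerivationOn V D) {ι : Type*} {s : Finset ι} {F : ι → C2 → ℂ}
    (hF : ∀ i ∈ s, SmoothOn V (F i)) :
    Set.EqOn (D (∑ i ∈ s, F i)) (∑ i ∈ s, D (F i)) V := by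
  classical
  induction s using Finset.induction_on with
  | empty => simpa using hD.zero
  | insert a s ha ih =>
    intro p hp
    rw [Finset.sum_insert ha, Finset.sum_insert ha,
      hD.add (hF a (by simp)) (SmoothOn.sum fun i hi => hF i (by simp [hi])) hp]
    simp only [Pi.add_apply]
    rw [ih (fun i hi => hF i (by simp [hi])) hp]

theorem pow (hD : IsDerivationOn V D) {f : C2 → ℂ} (hf : SmoothOn V f) (n : ℕ) :
    Set.EqOn (D (f ^ (n + 1))) ((n + 1 : ℂ) • (f ^ n * D f)) V := by
  induction n with
  | zero => intro p _; simp
  | succ n ih =>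
    intro p hp
    rw [pow_succ f (n + 1), hD.mul (hf.pow _) hf hp]
    simp only [Pi.add_apply, Pi.mul_apply, ih hp, Pi.smul_apply, Pi.pow_apply, smul_eq_mul]
    push_cast
    ring

theorem iterate_smooth (hD : IsDerivationOn V D) {f : C2 → ℂ} (hf : SmoothOn V f) (n : ℕ) :
    SmoothOn V (D^[n] f) := by
  induction n with
  | zero => exact hf
  | succ n ih => rw [Function.iterate_succ_apply']; exact hD.smooth ih

theorem iterate_congr (hD : IsDerivationOn V D) {f h : C2 → ℂ} (e : Set.EqOn f h V) (n : ℕ) :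
    Set.EqOn (D^[n] f) (D^[n] h) V := by
  induction n with
  | zero => exact e
  | succ n ih => simp only [Function.iterate_succ_apply']; exact hD.congr ih

theorem iterate_zero (hD : IsDerivationOn V D) (n : ℕ) : Set.EqOn (D^[n] 0) 0 V := by
  induction n with
  | zero => intro p _; rfl
  | succ n ih =>
    rw [Function.iterate_succ_apply']
    exact fun p hp => (hD.congr ih hp).trans (hD.zero hp)

theorem iterate_add (hD : IsDerivationOn V D) {f h : C2 → ℂ} (hf : SmoothOn V f)
    (hh : SmoothOn V h) (n : ℕ) : Set.EqOn (D^[n] (f + h)) (D^[n] f + D^[n] h) V := by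
  induction n with
  | zero => intro p _; rfl
  | succ n ih =>
    simp only [Function.iterate_succ_apply']
    exact fun p hp => (hD.congr ih hp).trans
      (hD.add (hD.iterate_smooth hf n) (hD.iterate_smooth hh n) hp)

theorem iterate_smul (hD : IsDerivationOn V D) (c : ℂ) {f : C2 → ℂ} (hf : SmoothOn V f) (n : ℕ) :
    Set.EqOn (D^[n] (c • f)) (c • D^[n] f) V := by
  induction n with
  | zero => intro p _; rfl
  | succ n ih =>
    simp only [Function.iterate_succ_apply']
    exact fun p hp => (hD.congr ih hp).trans (hD.smul c (hD.iterate_smooth hf n) hp)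

theorem iterate_sum (hD : IsDerivationOn V D) {ι : Type*} {s : Finset ι} {F : ι → C2 → ℂ}
    (hF : ∀ i ∈ s, SmoothOn V (F i)) (n : ℕ) :
    Set.EqOn (D^[n] (∑ i ∈ s, F i)) (∑ i ∈ s, D^[n] (F i)) V := by
  induction n with
  | zero => intro p _; rfl
  | succ n ih =>
    simp only [Function.iterate_succ_apply']
    exact fun p hp => (hD.congr ih hp).trans
      (hD.sum (fun i hi => hD.iterate_smooth (hF i hi) n) hp)

/-- A factor annihilated by the derivation can be pulled out. -/
theorem iterate_mul_of_eq_zero (hD : IsDerivationOn V D) {f h : C2 → ℂ} (hf : SmoothOn V f)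
    (hh : SmoothOn V h) (h0 : Set.EqOn (D f) 0 V) (n : ℕ) :
    Set.EqOn (D^[n] (f * h)) (f * D^[n] h) V := by
  induction n with
  | zero => intro p _; rfl
  | succ n ih =>
    simp only [Function.iterate_succ_apply']
    intro p hp
    rw [hD.congr ih hp, hD.mul hf (hD.iterate_smooth hh n) hp]
    simp [h0 hp]

/-- A combination of derivations with smooth coefficients is a derivation. -/
theorem comb {ι : Type*} {s : Finset ι} {a : ι → C2 → ℂ} {E : ι → (C2 → ℂ) → C2 → ℂ}
    (ha : ∀ i ∈ s, SmoothOn V (a i)) (hE : ∀ i ∈ s, IsDerivationOn V (E i)) :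
    IsDerivationOn V fun f p => ∑ i ∈ s, a i p * E i f p where
  smooth {f} hf := by
    have : SmoothOn V (∑ i ∈ s, a i * E i f) :=
      SmoothOn.sum fun i hi => (ha i hi).mul ((hE i hi).smooth hf)
    exact this.congr fun p _ => by simp
  congr e p hp := Finset.sum_congr rfl fun i hi => by rw [(hE i hi).congr e hp]
  add hf hh p hp := by
    simp only [Pi.add_apply, ← Finset.sum_add_distrib]
    exact Finset.sum_congr rfl fun i hi => by rw [(hE i hi).add hf hh hp, Pi.add_apply]; ring
  mul hf hh p hp := by
    simp only [Pi.add_apply, Pi.mul_apply, Finset.sum_mul, Finset.mul_sum,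
      ← Finset.sum_add_distrib]
    exact Finset.sum_congr rfl fun i hi => by
      rw [(hE i hi).mul hf hh hp, Pi.add_apply, Pi.mul_apply, Pi.mul_apply]; ring
  const c p hp := Finset.sum_eq_zero fun i hi => by rw [(hE i hi).const c hp]; simp

end IsDerivationOn

/-! ### Wirtinger derivatives -/

/-- The common form `(∂/∂x^k + s ∂/∂y^k) / 2` of the Wirtinger derivatives. -/
def wirtinger (s : ℂ) (k : Fin 2) (f : C2 → ℂ) : C2 → ℂ := fun p =>
  (1 / 2 : ℂ) * (fderiv ℝ f p (Pi.single k 1) + s * fderiv ℝ f p (Pi.single k Complex.I))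

theorem dz_eq_wirtinger (k : Fin 2) : dz k = wirtinger (-Complex.I) k := by
  funext f p; simp only [dz, wirtinger]; ring

theorem dzbar_eq_wirtinger (k : Fin 2) : dzbar k = wirtinger Complex.I k := rfl

theorem SmoothOn.fderiv_apply {V : Set C2} {f : C2 → ℂ} (hV : IsOpen V) (hf : SmoothOn V f)
    (w : C2) : SmoothOn V fun p => fderiv ℝ f p w :=
  (ContDiffOn.fderiv_of_isOpen (m := ∞) hf hV (by simp)).clm_apply contDiffOn_const

theorem isDerivationOn_wirtinger {V : Set C2} (hV : IsOpen V) (s : ℂ) (k : Fin 2) :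
    IsDerivationOn V (wirtinger s k) where
  smooth {f} hf := by
    have := ((hf.fderiv_apply hV (Pi.single k 1)).add
      (SmoothOn.smul s (hf.fderiv_apply hV (Pi.single k Complex.I)))).smul (1 / 2)
    exact this
  congr {f h} e p hp := by
    have : f =ᶠ[nhds p] h := Filter.eventuallyEq_of_mem (hV.mem_nhds hp) e
    simp only [wirtinger, this.fderiv_eq]
  add {f h} hf hh p hp := by
    simp only [wirtinger, Pi.add_apply,
      fderiv_add (hf.differentiableAt hV hp) (hh.differentiableAt hV hp)]
    simp only [add_apply]
    ring
  mul {f h} hf hh p hp := by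
    simp only [wirtinger, Pi.add_apply, Pi.mul_apply,
      fderiv_mul (hf.differentiableAt hV hp) (hh.differentiableAt hV hp)]
    simp only [add_apply, smul_apply, smul_eq_mul]
    ring
  const c p _ := by simp [wirtinger]

theorem isDerivationOn_dz {V : Set C2} (hV : IsOpen V) (k : Fin 2) : IsDerivationOn V (dz k) := by
  rw [dz_eq_wirtinger]; exact isDerivationOn_wirtinger hV _ k

theorem isDerivationOn_dzbar {V : Set C2} (hV : IsOpen V) (k : Fin 2) :
    IsDerivationOn V (dzbar k) := by
  rw [dzbar_eq_wirtinger]; exact isDerivationOn_wirtinger hV _ k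

/-- Both sides are the same combination of second real derivatives, whose symmetry is all that is
needed. The free parameters s and t cover the holomorphic, antiholomorphic and mixed cases at once.
-/
theorem wirtinger_comm {V : Set C2} (hV : IsOpen V) {f : C2 → ℂ} (hf : SmoothOn V f) (s t : ℂ)
    (k l : Fin 2) : Set.EqOn (wirtinger s k (wirtinger t l f)) (wirtinger t l (wirtinger s k f)) V := by
  intro p hp
  have hd : DifferentiableAt ℝ (fderiv ℝ f) p :=
    ((ContDiffOn.fderiv_of_isOpen (m := ∞) hf hV (by simp)).contDiffAt
      (hV.mem_nhds hp)).differentiableAt (by simp)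
  have key : ∀ (t : ℂ) (l : Fin 2) (w : C2), fderiv ℝ (wirtinger t l f) p w
      = (1 / 2 : ℂ) * (fderiv ℝ (fderiv ℝ f) p w (Pi.single l 1)
        + t * fderiv ℝ (fderiv ℝ f) p w (Pi.single l Complex.I)) := by
    intro t l w
    have h1 : ∀ x : C2, HasFDerivAt (fun q => fderiv ℝ f q x)
        ((fderiv ℝ (fderiv ℝ f) p).flip x) p := fun x => by
      simpa using hd.hasFDerivAt.clm_apply (hasFDerivAt_const x p)
    have h2 := ((h1 (Pi.single l 1)).add ((h1 (Pi.single l Complex.I)).const_mul t)).const_mul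
      (1 / 2 : ℂ)
    have h3 : HasFDerivAt (wirtinger t l f) _ p := h2
    rw [h3.fderiv]
    simp
    ring
  have hs : IsSymmSndFDerivAt ℝ f p :=
    (ContDiffOn.contDiffAt hf (hV.mem_nhds hp)).isSymmSndFDerivAt
      (by
        rw [minSmoothness_of_isRCLikeNormedField]
        exact WithTop.coe_le_coe.2 (le_top : (2 : ℕ∞) ≤ ⊤))
  rw [wirtinger, wirtinger, key, key, key, key, hs.eq (Pi.single k 1) (Pi.single l 1),
    hs.eq (Pi.single k 1) (Pi.single l Complex.I), hs.eq (Pi.single k Complex.I) (Pi.single l 1),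
    hs.eq (Pi.single k Complex.I) (Pi.single l Complex.I)]
  ring

theorem dz_dzbar_comm {V : Set C2} (hV : IsOpen V) {f : C2 → ℂ} (hf : SmoothOn V f)
    (k l : Fin 2) : Set.EqOn (dz k (dzbar l f)) (dzbar l (dz k f)) V := by
  rw [dz_eq_wirtinger, dzbar_eq_wirtinger]; exact wirtinger_comm hV hf _ _ _ _

theorem dz_comm {V : Set C2} (hV : IsOpen V) {f : C2 → ℂ} (hf : SmoothOn V f)
    (k l : Fin 2) : Set.EqOn (dz k (dz l f)) (dz l (dz k f)) V := by
  rw [dz_eq_wirtinger, dz_eq_wirtinger]; exact wirtinger_comm hV hf _ _ _ _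

theorem dzbar_comm {V : Set C2} (hV : IsOpen V) {f : C2 → ℂ} (hf : SmoothOn V f)
    (k l : Fin 2) : Set.EqOn (dzbar k (dzbar l f)) (dzbar l (dzbar k f)) V := by
  rw [dzbar_eq_wirtinger, dzbar_eq_wirtinger]; exact wirtinger_comm hV hf _ _ _ _

theorem fderiv_star (f : C2 → ℂ) (p w : C2) :
    fderiv ℝ (star f) p w = star (fderiv ℝ f p w) := by
  have : star f = Complex.conjCLE ∘ f := rfl
  rw [this, Complex.conjCLE.comp_fderiv]
  rfl

theorem dz_star (k : Fin 2) (f : C2 → ℂ) : dz k (star f) = star (dzbar k f) := by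
  funext p
  simp only [dz, dzbar, Pi.star_apply, fderiv_star]
  simp
  ring

theorem dzbar_star (k : Fin 2) (f : C2 → ℂ) : dzbar k (star f) = star (dz k f) := by
  rw [← star_star (dzbar k (star f)), ← dz_star, star_star]

/-! ### The inverse metric and the operators `D^k`, `D^k̄` -/

theorem gUp_eq_fromBlocks {g : C2 → Matrix (Fin 2) (Fin 2) ℂ} {q : C2} (h : (g q).PosDef) :
    gUp g q = Matrix.fromBlocks 0 ((g q)⁻¹).transpose (g q)⁻¹ 0 := by
  have hu : IsUnit (g q).det := (Matrix.isUnit_iff_isUnit_det _).1 h.isUnit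
  refine Matrix.inv_eq_right_inv ?_
  rw [gLow, Matrix.fromBlocks_multiply, Matrix.mul_nonsing_inv _ hu, ← Matrix.transpose_mul,
    Matrix.nonsing_inv_mul _ hu]
  simp

section

variable {g : C2 → Matrix (Fin 2) (Fin 2) ℂ} {q : C2}

theorem gUp_inl_inl (h : (g q).PosDef) (k l : Fin 2) : gUp g q (Sum.inl k) (Sum.inl l) = 0 := by
  rw [gUp_eq_fromBlocks h]; rfl

theorem gUp_inl_inr (h : (g q).PosDef) (k l : Fin 2) :
    gUp g q (Sum.inl k) (Sum.inr l) = (g q)⁻¹ l k := by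
  rw [gUp_eq_fromBlocks h]; rfl

theorem gUp_inr_inl (h : (g q).PosDef) (k l : Fin 2) :
    gUp g q (Sum.inr k) (Sum.inl l) = (g q)⁻¹ k l := by
  rw [gUp_eq_fromBlocks h]; rfl

theorem gUp_inr_inr (h : (g q).PosDef) (k l : Fin 2) : gUp g q (Sum.inr k) (Sum.inr l) = 0 := by
  rw [gUp_eq_fromBlocks h]; rfl

theorem sum_inv_mul (h : (g q).PosDef) (k l : Fin 2) :
    ∑ m, (g q)⁻¹ k m * g q m l = if k = l then 1 else 0 := by
  rw [← Matrix.mul_apply, Matrix.nonsing_inv_mul _ ((Matrix.isUnit_iff_isUnit_det _).1 h.isUnit),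
    Matrix.one_apply]

theorem sum_mul_inv (h : (g q).PosDef) (k l : Fin 2) :
    ∑ m, g q k m * (g q)⁻¹ m l = if k = l then 1 else 0 := by
  rw [← Matrix.mul_apply, Matrix.mul_nonsing_inv _ ((Matrix.isUnit_iff_isUnit_det _).1 h.isUnit),
    Matrix.one_apply]

theorem star_inv_apply (h : (g q).PosDef) (k l : Fin 2) : star ((g q)⁻¹ k l) = (g q)⁻¹ l k :=
  h.inv.isHermitian.apply l k

theorem DopBar_eq (h : (g q).PosDef) (k : Fin 2) (f : C2 → ℂ) :
    DopBar g k f q = ∑ l, (g q)⁻¹ k l * dz l f q := by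
  simp only [DopBar, gUp_inr_inl h]

theorem Dop_eq (h : (g q).PosDef) (k : Fin 2) (f : C2 → ℂ) :
    Dop g k f q = ∑ l, (g q)⁻¹ l k * dzbar l f q := by
  simp only [Dop, gUp_inl_inr h]

theorem Dop_star (h : (g q).PosDef) (k : Fin 2) (f : C2 → ℂ) :
    Dop g k (star f) q = star (DopBar g k f q) := by
  simp only [Dop_eq h, DopBar_eq h, dzbar_star, star_sum, star_mul', star_inv_apply h,
    Pi.star_apply]

/-- `∂_l̄ = g_{k l̄} D^k`. -/
theorem dzbar_eq_sum_Dop (h : (g q).PosDef) (l : Fin 2) (f : C2 → ℂ) :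
    dzbar l f q = ∑ k, g q k l * Dop g k f q := by
  simp only [Dop_eq h, Finset.mul_sum]
  rw [Finset.sum_comm]
  have : ∀ m, ∑ k, g q k l * ((g q)⁻¹ m k * dzbar m f q)
      = (∑ k, (g q)⁻¹ m k * g q k l) * dzbar m f q := fun m => by
    rw [Finset.sum_mul]; exact Finset.sum_congr rfl fun k _ => by ring
  simp [this, sum_inv_mul h]

/-- `∂_l = g_{l k̄} D^k̄`. -/
theorem dz_eq_sum_DopBar (h : (g q).PosDef) (l : Fin 2) (f : C2 → ℂ) :
    dz l f q = ∑ k, g q l k * DopBar g k f q := by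
  simp only [DopBar_eq h, Finset.mul_sum]
  rw [Finset.sum_comm]
  have : ∀ m, ∑ k, g q l k * ((g q)⁻¹ k m * dz m f q)
      = (∑ k, g q l k * (g q)⁻¹ k m) * dz m f q := fun m => by
    rw [Finset.sum_mul]; exact Finset.sum_congr rfl fun k _ => by ring
  simp [this, sum_mul_inv h]

end

theorem gLow_symm (g : C2 → Matrix (Fin 2) (Fin 2) ℂ) (q : C2) (A B : Idx) :
    gLow g q A B = gLow g q B A := by
  rcases A with k | k <;> rcases B with l | l <;> simp [gLow]

theorem christoffel_symm (g : C2 → Matrix (Fin 2) (Fin 2) ℂ) (A B C : Idx) :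
    christoffel g A B C = christoffel g A C B := by
  funext q
  simp only [christoffel, gLow_symm g _ B C]
  congr 1
  exact Finset.sum_congr rfl fun D _ => by ring

section

variable {U V : Set C2} {g : C2 → Matrix (Fin 2) (Fin 2) ℂ} {Φ : C2 → ℝ}

theorem IsKahlerOn.smooth_inv (hg : IsKahlerOn U g) (k l : Fin 2) :
    SmoothOn U fun q => (g q)⁻¹ k l := by
  have hdet : SmoothOn U fun q => (g q).det := by
    have := ((hg.smooth 0 0).mul (hg.smooth 1 1)).sub ((hg.smooth 0 1).mul (hg.smooth 1 0))
    exact this.congr fun q _ => by simp [Matrix.det_fin_two]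
  have hinv : SmoothOn U fun q => ((g q).det)⁻¹ :=
    ContDiffOn.inv hdet fun q hq =>
      ((Matrix.isUnit_iff_isUnit_det _).1 (hg.posDef q hq).isUnit).ne_zero
  have hadj : SmoothOn U fun q => (g q).adjugate k l := by
    simp only [Matrix.adjugate_fin_two]
    fin_cases k <;> fin_cases l
    · exact hg.smooth 1 1
    · exact ((hg.smooth 0 1).smul (-1)).congr fun q _ => by simp
    · exact ((hg.smooth 1 0).smul (-1)).congr fun q _ => by simp
    · exact hg.smooth 0 0
  exact (hinv.mul hadj).congr fun q _ => by simp [Matrix.inv_def]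

theorem IsKahlerOn.smooth_gUp (hg : IsKahlerOn U g) (A B : Idx) :
    SmoothOn U fun q => gUp g q A B := by
  rcases A with k | k <;> rcases B with l | l
  · exact SmoothOn.zero.congr fun q hq => gUp_inl_inl (hg.posDef q hq) k l
  · exact (hg.smooth_inv l k).congr fun q hq => gUp_inl_inr (hg.posDef q hq) k l
  · exact (hg.smooth_inv k l).congr fun q hq => gUp_inr_inl (hg.posDef q hq) k l
  · exact SmoothOn.zero.congr fun q hq => gUp_inr_inr (hg.posDef q hq) k l

theorem isDerivationOn_Dop (hg : IsKahlerOn U g) (hV : IsOpen V) (hVU : V ⊆ U) (k : Fin 2) :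
    IsDerivationOn V (Dop g k) :=
  IsDerivationOn.comb (fun _ _ => (hg.smooth_gUp _ _).mono hVU) fun l _ => isDerivationOn_dzbar hV l

theorem isDerivationOn_DopBar (hg : IsKahlerOn U g) (hV : IsOpen V) (hVU : V ⊆ U) (k : Fin 2) :
    IsDerivationOn V (DopBar g k) :=
  IsDerivationOn.comb (fun _ _ => (hg.smooth_gUp _ _).mono hVU) fun l _ => isDerivationOn_dz hV l

/-! ### Local potentials: dual coordinates, Christoffel symbols and curvature. -/

namespace IsPotentialOn

theorem smoothOn (hΦ : IsPotentialOn V g Φ) : SmoothOn V fun q => (Φ q : ℂ) :=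
  (Complex.ofRealCLM.contDiff (n := ∞)).comp_contDiffOn hΦ.smooth

theorem eq' (hV : IsOpen V) (hΦ : IsPotentialOn V g Φ) {q : C2} (hq : q ∈ V) (k l : Fin 2) :
    dzbar l (dz k fun q => (Φ q : ℂ)) q = g q k l := by
  rw [hΦ.eq q hq, dz_dzbar_comm hV hΦ.smoothOn k l hq]

theorem DopBar_dzbar (hg : IsKahlerOn U g) (hVU : V ⊆ U) (hΦ : IsPotentialOn V g Φ) (k l : Fin 2) :
    Set.EqOn (DopBar g k (dzbar l fun q => (Φ q : ℂ))) (fun _ => if k = l then 1 else 0) V := by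
  intro q hq
  simp only [DopBar_eq (hg.posDef q (hVU hq)), ← hΦ.eq q hq, sum_inv_mul (hg.posDef q (hVU hq))]

theorem Dop_dz (hg : IsKahlerOn U g) (hV : IsOpen V) (hVU : V ⊆ U) (hΦ : IsPotentialOn V g Φ)
    (k l : Fin 2) :
    Set.EqOn (Dop g k (dz l fun q => (Φ q : ℂ))) (fun _ => if k = l then 1 else 0) V := by
  intro q hq
  simp only [Dop_eq (hg.posDef q (hVU hq)), hΦ.eq' hV hq, mul_comm _ (g q _ _),
    sum_mul_inv (hg.posDef q (hVU hq)), eq_comm]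

/-! ### Curvature of a Kähler metric in terms of a potential -/

theorem dz_metric_symm (hV : IsOpen V) (hΦ : IsPotentialOn V g Φ) (k l m : Fin 2) :
    Set.EqOn (dz k fun q => g q l m) (dz l fun q => g q k m) V := by
  intro q hq
  have h : ∀ a b, Set.EqOn (fun q => g q a b) (dz a (dzbar b fun q => (Φ q : ℂ))) V :=
    fun a b q hq => hΦ.eq q hq a b
  rw [(isDerivationOn_dz hV k).congr (h l m) hq, (isDerivationOn_dz hV l).congr (h k m) hq,
    dz_comm hV ((isDerivationOn_dzbar hV m).smooth hΦ.smoothOn) k l hq]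

theorem dzbar_metric_symm (hV : IsOpen V) (hΦ : IsPotentialOn V g Φ) (k l m : Fin 2) :
    Set.EqOn (dzbar k fun q => g q m l) (dzbar l fun q => g q m k) V := by
  intro q hq
  have h : ∀ a b, Set.EqOn (fun q => g q a b) (dzbar b (dz a fun q => (Φ q : ℂ))) V :=
    fun a b q hq => (hΦ.eq' hV hq a b).symm
  rw [(isDerivationOn_dzbar hV k).congr (h m l) hq, (isDerivationOn_dzbar hV l).congr (h m k) hq,
    dzbar_comm hV ((isDerivationOn_dz hV m).smooth hΦ.smoothOn) k l hq]

theorem christoffel_inl_inl_inl (hg : IsKahlerOn U g) (hV : IsOpen V) (hVU : V ⊆ U)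
    (hΦ : IsPotentialOn V g Φ) (e r s : Fin 2) :
    Set.EqOn (christoffel g (Sum.inl e) (Sum.inl r) (Sum.inl s))
      (fun q => ∑ d, (g q)⁻¹ d e * dz r (fun x => g x s d) q) V := by
  intro q hq
  have hp := hg.posDef q (hVU hq)
  simp only [christoffel, Fintype.sum_sum_type, gUp_inl_inl hp, gUp_inl_inr hp, gLow, pd,
    Matrix.fromBlocks_apply₁₁, Matrix.fromBlocks_apply₂₁, Sum.elim_inl, Sum.elim_inr,
    Matrix.transpose_apply, Matrix.zero_apply, zero_mul, Finset.sum_const_zero, zero_add]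
  rw [Finset.mul_sum]
  refine Finset.sum_congr rfl fun d _ => ?_
  rw [(isDerivationOn_dzbar hV d).const 0 hq, hΦ.dz_metric_symm hV s r d hq]
  simp
  ring

theorem christoffel_inl_inr_inl (hg : IsKahlerOn U g) (hV : IsOpen V) (hVU : V ⊆ U)
    (hΦ : IsPotentialOn V g Φ) (e l s : Fin 2) :
    Set.EqOn (christoffel g (Sum.inl e) (Sum.inr l) (Sum.inl s)) 0 V := by
  intro q hq
  have hp := hg.posDef q (hVU hq)
  simp only [christoffel, Fintype.sum_sum_type, gUp_inl_inl hp, gUp_inl_inr hp, gLow, pd,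
    Matrix.fromBlocks_apply₂₂, Matrix.fromBlocks_apply₂₁, Sum.elim_inl, Sum.elim_inr,
    Matrix.transpose_apply, Matrix.zero_apply, zero_mul, Finset.sum_const_zero, zero_add]
  rw [Finset.mul_sum]
  refine Finset.sum_eq_zero fun d _ => ?_
  rw [(isDerivationOn_dz hV s).const 0 hq, hΦ.dzbar_metric_symm hV l d s hq]
  simp

theorem christoffel_inl_inr_inr (hg : IsKahlerOn U g) (hV : IsOpen V) (hVU : V ⊆ U)
    (e l s : Fin 2) :
    Set.EqOn (christoffel g (Sum.inl e) (Sum.inr l) (Sum.inr s)) 0 V := by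
  intro q hq
  have hp := hg.posDef q (hVU hq)
  simp only [christoffel, Fintype.sum_sum_type, gUp_inl_inl hp, gUp_inl_inr hp, gLow, pd,
    Matrix.fromBlocks_apply₂₂, Sum.elim_inl, Sum.elim_inr,
    Matrix.zero_apply, zero_mul, Finset.sum_const_zero, zero_add]
  rw [Finset.mul_sum]
  refine Finset.sum_eq_zero fun d _ => ?_
  rw [(isDerivationOn_dzbar hV s).const 0 hq, (isDerivationOn_dzbar hV l).const 0 hq,
    (isDerivationOn_dzbar hV d).const 0 hq]
  simp

theorem christoffel_inr_inl_inl (hg : IsKahlerOn U g) (hV : IsOpen V) (hVU : V ⊆ U)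
    (e l s : Fin 2) :
    Set.EqOn (christoffel g (Sum.inr e) (Sum.inl l) (Sum.inl s)) 0 V := by
  intro q hq
  have hp := hg.posDef q (hVU hq)
  simp only [christoffel, Fintype.sum_sum_type, gUp_inr_inl hp, gUp_inr_inr hp, gLow, pd,
    Matrix.fromBlocks_apply₁₁, Matrix.fromBlocks_apply₂₁, Sum.elim_inl, Sum.elim_inr,
    Matrix.transpose_apply, Matrix.zero_apply, zero_mul, Finset.sum_const_zero, add_zero]
  rw [Finset.mul_sum]
  refine Finset.sum_eq_zero fun d _ => ?_
  rw [(isDerivationOn_dz hV s).const 0 hq, (isDerivationOn_dz hV l).const 0 hq,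
    (isDerivationOn_dz hV d).const 0 hq]
  simp

/-- The mixed Christoffel symbols vanish by the Kähler condition, so every quadratic term of the
curvature drops out and only the antiholomorphic derivative of the pure symbol remains. -/
theorem riem_inr_inl_inl_inl (hg : IsKahlerOn U g) (hV : IsOpen V) (hVU : V ⊆ U)
    (hΦ : IsPotentialOn V g Φ) (l r s e : Fin 2) :
    Set.EqOn (riem g (Sum.inr l) (Sum.inl r) (Sum.inl s) (Sum.inl e))
      (dzbar l fun q => ∑ d, (g q)⁻¹ d e * dz r (fun x => g x s d) q) V := by
  intro q hq
  have h1 := (isDerivationOn_dzbar hV l).congr (hΦ.christoffel_inl_inl_inl hg hV hVU e r s) hq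
  have h2 := (isDerivationOn_dz hV r).congr (hΦ.christoffel_inl_inr_inl hg hV hVU e l s) hq
  rw [(isDerivationOn_dz hV r).zero hq] at h2
  simp only [riem, pd, Sum.elim_inl, Sum.elim_inr, Fintype.sum_sum_type, h1, h2,
    hΦ.christoffel_inl_inr_inl hg hV hVU _ _ _ hq, christoffel_inl_inr_inr hg hV hVU _ _ _ hq,
    christoffel_inr_inl_inl hg hV hVU _ _ _ hq]
  simp [christoffel_symm g (Sum.inl e) (Sum.inl r) (Sum.inr _),
    hΦ.christoffel_inl_inr_inl hg hV hVU _ _ _ hq]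

/-- In matrix form, with M = (∂_r g) g⁻¹ and N = g⁻¹ (∂_l̄ g), this is (∂_l̄ M) g = g (∂_r N). It
comes from differentiating ∂_r g = M g and ∂_l̄ g = g N once more and equating the mixed
derivatives. It turns the Christoffel form of the curvature into the form produced by applying D^ā
and then D^c̄ to ∂_l̄ ∂_b̄ Φ. -/
theorem dzbar_sum_eq_dz_sum (hg : IsKahlerOn U g) (hV : IsOpen V) (hVU : V ⊆ U)
    (l r s b : Fin 2) {q : C2} (hq : q ∈ V) :
    ∑ e, g q e b * dzbar l (fun q => ∑ d, (g q)⁻¹ d e * dz r (fun x => g x s d) q) q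
      = ∑ a, g q s a * dz r (fun q => ∑ m, (g q)⁻¹ a m * dzbar l (fun x => g x m b) q) q := by
  have hgs : ∀ i j, SmoothOn V fun x => g x i j := fun i j => (hg.smooth i j).mono hVU
  have hinv : ∀ i j, SmoothOn V fun x => (g x)⁻¹ i j := fun i j => (hg.smooth_inv i j).mono hVU
  have dr := isDerivationOn_dz hV r
  have dl := isDerivationOn_dzbar hV l
  set M : Fin 2 → C2 → ℂ := fun e q => ∑ d, (g q)⁻¹ d e * dz r (fun x => g x s d) q with hM
  set N : Fin 2 → C2 → ℂ := fun a q => ∑ m, (g q)⁻¹ a m * dzbar l (fun x => g x m b) q with hN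
  have sM : ∀ e, SmoothOn V (M e) := fun e =>
    (SmoothOn.sum (s := Finset.univ) fun d _ => (hinv d e).mul (dr.smooth (hgs s d))).congr
      fun q _ => by simp [hM]
  have sN : ∀ a, SmoothOn V (N a) := fun a =>
    (SmoothOn.sum (s := Finset.univ) fun m _ => (hinv a m).mul (dl.smooth (hgs m b))).congr
      fun q _ => by simp [hN]
  have eM : Set.EqOn (dz r fun x => g x s b) (∑ e, M e * fun x => g x e b) V := by
    intro x hx
    simp only [Finset.sum_apply, Pi.mul_apply, hM, Finset.sum_mul]
    rw [Finset.sum_comm]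
    have : ∀ d, ∑ e, (g x)⁻¹ d e * dz r (fun x => g x s d) x * g x e b
        = dz r (fun x => g x s d) x * ∑ e, (g x)⁻¹ d e * g x e b := fun d => by
      rw [Finset.mul_sum]; exact Finset.sum_congr rfl fun k _ => by ring
    simp [this, sum_inv_mul (hg.posDef x (hVU hx))]
  have eN : Set.EqOn (dzbar l fun x => g x s b) (∑ a, (fun x => g x s a) * N a) V := by
    intro x hx
    simp only [Finset.sum_apply, Pi.mul_apply, hN, Finset.mul_sum]
    rw [Finset.sum_comm]
    have : ∀ m, ∑ a, g x s a * ((g x)⁻¹ a m * dzbar l (fun x => g x m b) x)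
        = (∑ a, g x s a * (g x)⁻¹ a m) * dzbar l (fun x => g x m b) x := fun d => by
      rw [Finset.sum_mul]; exact Finset.sum_congr rfl fun k _ => by ring
    simp [this, sum_mul_inv (hg.posDef x (hVU hx))]
  have h1 := dl.congr eM hq
  rw [dl.sum (fun e _ => (sM e).mul (hgs e b)) hq] at h1
  have h2 := dr.congr eN hq
  rw [dr.sum (fun a _ => (hgs s a).mul (sN a)) hq, dz_dzbar_comm hV (hgs s b) r l hq, h1] at h2
  simp only [Finset.sum_apply, dl.mul (sM _) (hgs _ b) hq, dr.mul (hgs s _) (sN _) hq, Pi.add_apply,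
    Pi.mul_apply, Finset.sum_add_distrib] at h2
  -- The first-order products agree, since M (∂_l̄ g) = (∂_r g) g⁻¹ (∂_l̄ g) = (∂_r g) N, and
  -- cancel.
  have h3 : ∑ e, M e q * dzbar l (fun x => g x e b) q
      = ∑ a, dz r (fun x => g x s a) q * N a q := by
    simp only [hM, hN, Finset.mul_sum, Finset.sum_mul]
    rw [Finset.sum_comm]
    exact Finset.sum_congr rfl fun _ _ => Finset.sum_congr rfl fun _ _ => by ring
  rw [h3, add_comm] at h2
  simpa only [mul_comm (g q _ b)] using add_left_cancel h2

/-- `R_l̄^{c̄ ā}_b̄ = D^c̄ D^ā ∂_l̄ ∂_b̄ Φ`. -/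
theorem DopBar_DopBar_eq_curv (hg : IsKahlerOn U g) (hV : IsOpen V) (hVU : V ⊆ U)
    (hΦ : IsPotentialOn V g Φ) (l c a b : Fin 2) :
    Set.EqOn (DopBar g c (DopBar g a (dzbar l (dzbar b fun q => (Φ q : ℂ))))) (curv g l c a b)
      V := by
  intro q hq
  have hp := hg.posDef q (hVU hq)
  have e1 : Set.EqOn (DopBar g a (dzbar l (dzbar b fun q => (Φ q : ℂ))))
      (fun q => ∑ m, (g q)⁻¹ a m * dzbar l (fun x => g x m b) q) V := by
    intro x hx
    rw [DopBar_eq (hg.posDef x (hVU hx))]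
    refine Finset.sum_congr rfl fun m _ => ?_
    rw [dz_dzbar_comm hV ((isDerivationOn_dzbar hV b).smooth hΦ.smoothOn) m l hx]
    exact congrArg _ ((isDerivationOn_dzbar hV l).congr (fun y hy => (hΦ.eq y hy m b).symm) hx)
  rw [(isDerivationOn_DopBar hg hV hVU c).congr e1 hq, DopBar_eq hp, curv]
  refine Finset.sum_congr rfl fun r _ => ?_
  have e2 : ∀ s, riemLow g (Sum.inr l) (Sum.inl r) (Sum.inl s) (Sum.inr b) q
      = ∑ a, g q s a * dz r (fun q => ∑ m, (g q)⁻¹ a m * dzbar l (fun x => g x m b) q) q := by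
    intro s
    rw [← dzbar_sum_eq_dz_sum hg hV hVU l r s b hq]
    simp only [riemLow, Fintype.sum_sum_type, gLow, Matrix.fromBlocks_apply₂₂,
      Matrix.fromBlocks_apply₂₁, Matrix.transpose_apply, Matrix.zero_apply, zero_mul,
      Finset.sum_const_zero, add_zero, hΦ.riem_inr_inl_inl_inl hg hV hVU l r s _ hq]
  simp only [gUp_inr_inl hp, e2, mul_assoc, ← Finset.mul_sum]
  congr 1
  simp only [Finset.mul_sum]
  rw [Finset.sum_comm]
  have : ∀ a', ∑ s, (g q)⁻¹ a s * (g q s a' *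
      dz r (fun q => ∑ m, (g q)⁻¹ a' m * dzbar l (fun x => g x m b) q) q)
      = (∑ s, (g q)⁻¹ a s * g q s a') *
        dz r (fun q => ∑ m, (g q)⁻¹ a' m * dzbar l (fun x => g x m b) q) q := fun d => by
    rw [Finset.sum_mul]; exact Finset.sum_congr rfl fun k _ => by ring
  simp only [this, sum_inv_mul hp, ite_mul, one_mul, zero_mul, Finset.sum_ite_eq, Finset.mem_univ,
    if_true]

/-- Visible from D^c̄ D^ā ∂_l̄ ∂_b̄ Φ, because ∂_l̄ and ∂_b̄ commute. -/
theorem curv_symm_outer (hg : IsKahlerOn U g) (hV : IsOpen V) (hVU : V ⊆ U)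
    (hΦ : IsPotentialOn V g Φ) (l c a b : Fin 2) {q : C2} (hq : q ∈ V) :
    curv g l c a b q = curv g b c a l q := by
  rw [← hΦ.DopBar_DopBar_eq_curv hg hV hVU l c a b hq,
    ← hΦ.DopBar_DopBar_eq_curv hg hV hVU b c a l hq]
  exact (isDerivationOn_DopBar hg hV hVU c).congr
    ((isDerivationOn_DopBar hg hV hVU a).congr (dzbar_comm hV hΦ.smoothOn l b)) hq

theorem riem_symm (hg : IsKahlerOn U g) (hV : IsOpen V) (hVU : V ⊆ U)
    (hΦ : IsPotentialOn V g Φ) (l r s e : Fin 2) {q : C2} (hq : q ∈ V) :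
    riem g (Sum.inr l) (Sum.inl r) (Sum.inl s) (Sum.inl e) q
      = riem g (Sum.inr l) (Sum.inl s) (Sum.inl r) (Sum.inl e) q := by
  rw [hΦ.riem_inr_inl_inl_inl hg hV hVU l r s e hq, hΦ.riem_inr_inl_inl_inl hg hV hVU l s r e hq]
  refine (isDerivationOn_dzbar hV l).congr (fun x hx => ?_) hq
  exact Finset.sum_congr rfl fun d _ => by rw [hΦ.dz_metric_symm hV r s d hx]

/-- Here the Christoffel form is the convenient one: ∂_r g_{s d̄} is symmetric in r and s, and
raising the two indices preserves the symmetry. -/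
theorem curv_symm_inner (hg : IsKahlerOn U g) (hV : IsOpen V) (hVU : V ⊆ U)
    (hΦ : IsPotentialOn V g Φ) (l c a b : Fin 2) {q : C2} (hq : q ∈ V) :
    curv g l c a b q = curv g l a c b q := by
  have : ∀ r s, riemLow g (Sum.inr l) (Sum.inl r) (Sum.inl s) (Sum.inr b) q
      = riemLow g (Sum.inr l) (Sum.inl s) (Sum.inl r) (Sum.inr b) q := by
    intro r s
    simp only [riemLow, Fintype.sum_sum_type, gLow, Matrix.fromBlocks_apply₂₂,
      Matrix.fromBlocks_apply₂₁, Matrix.transpose_apply, Matrix.zero_apply, zero_mul,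
      Finset.sum_const_zero, add_zero, hΦ.riem_symm hg hV hVU l r s _ hq]
  rw [curv, curv, Finset.sum_comm]
  exact Finset.sum_congr rfl fun s _ => Finset.sum_congr rfl fun r _ => by rw [this]; ring

end IsPotentialOn

end

/-! ### Divided powers of dual coordinates -/

/-- The divided power `u^z / z!`, which is `0` for negative `z`. -/
def divPow (u : C2 → ℂ) : ℤ → C2 → ℂ
  | Int.ofNat n => (n.factorial : ℂ)⁻¹ • u ^ n
  | Int.negSucc _ => 0

theorem divPow_natCast (u : C2 → ℂ) (n : ℕ) : divPow u n = (n.factorial : ℂ)⁻¹ • u ^ n := rfl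

theorem divPow_of_neg (u : C2 → ℂ) {z : ℤ} (hz : z < 0) : divPow u z = 0 := by
  obtain ⟨n, rfl⟩ := Int.eq_negSucc_of_lt_zero hz
  rfl

theorem divPow_zero (u : C2 → ℂ) : divPow u 0 = 1 := by
  have := divPow_natCast u 0
  simpa using this

theorem divPow_one (u : C2 → ℂ) : divPow u 1 = u := by
  have := divPow_natCast u 1
  simpa using this

theorem divPow_apply_of_eq_zero {u : C2 → ℂ} {p : C2} (hu : u p = 0) (z : ℤ) :
    divPow u z p = if z = 0 then 1 else 0 := by
  rcases lt_or_ge z 0 with hz | hz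
  · rw [divPow_of_neg u hz, if_neg hz.ne]; rfl
  · lift z to ℕ using hz
    rcases z with _ | n
    · simp [divPow_zero]
    · rw [divPow_natCast, if_neg (by simp; omega)]
      simp [hu]

theorem mul_divPow (u : C2 → ℂ) (z : ℤ) : u * divPow u z = ((z : ℂ) + 1) • divPow u (z + 1) := by
  rcases lt_or_ge z 0 with hz | hz
  · rw [divPow_of_neg u hz]
    -- At z = -1 the right-hand power is 1, not 0; the factor z + 1 = 0 saves the identity.
    rcases (Int.add_one_le_iff.2 hz).lt_or_eq with h | h
    · rw [divPow_of_neg u h]; simp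
    · have : (z : ℂ) + 1 = 0 := by exact_mod_cast h
      simp [this]
  · lift z to ℕ using hz
    have h1 : ((z : ℤ) + 1) = ((z + 1 : ℕ) : ℤ) := by push_cast; rfl
    rw [h1, divPow_natCast, divPow_natCast, Nat.factorial_succ]
    ext q
    have h2 : (z : ℂ) + 1 ≠ 0 := Nat.cast_add_one_ne_zero z
    have h3 : (z.factorial : ℂ) ≠ 0 := by exact_mod_cast z.factorial_ne_zero
    simp only [Pi.mul_apply, Pi.smul_apply, Pi.pow_apply, smul_eq_mul]
    push_cast
    field_simp
    ring

theorem SmoothOn.divPow {V : Set C2} {u : C2 → ℂ} (hu : SmoothOn V u) (z : ℤ) :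
    SmoothOn V (divPow u z) := by
  cases z with
  | ofNat n => exact (hu.pow n).smul _
  | negSucc n => exact SmoothOn.zero

namespace IsDerivationOn

variable {V : Set C2} {D : (C2 → ℂ) → C2 → ℂ}

theorem divPow (hD : IsDerivationOn V D) {u : C2 → ℂ} (hu : SmoothOn V u) (z : ℤ) :
    Set.EqOn (D (divPow u z)) (divPow u (z - 1) * D u) V := by
  intro q hq
  rcases lt_or_ge z 0 with hz | hz
  · rw [divPow_of_neg u hz, divPow_of_neg u (by omega), hD.zero hq]; simp
  · lift z to ℕ using hz
    rcases z with _ | n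
    · rw [divPow_of_neg u (z := ((0 : ℕ) : ℤ) - 1) (by simp)]
      have h0 : KahlerStar.divPow u ((0 : ℕ) : ℤ) = fun _ => 1 := divPow_zero u
      rw [h0, hD.const 1 hq]
      simp
    · have h1 : ((n + 1 : ℕ) : ℤ) - 1 = n := by push_cast; ring
      rw [h1, divPow_natCast, divPow_natCast, hD.smul _ (hu.pow _) hq, Pi.smul_apply,
        hD.pow hu n hq, Nat.factorial_succ]
      have h2 : (n : ℂ) + 1 ≠ 0 := Nat.cast_add_one_ne_zero n
      simp only [Pi.mul_apply, Pi.smul_apply, Pi.pow_apply, smul_eq_mul]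
      push_cast
      field_simp

/-- The Leibniz rule for the product with a divided power of a dual coordinate. -/
theorem iterate_divPow_mul (hD : IsDerivationOn V D) {u : C2 → ℂ} (hu : SmoothOn V u)
    (h1 : Set.EqOn (D u) (fun _ => 1) V) (n : ℕ) :
    ∀ {G : C2 → ℂ}, SmoothOn V G → ∀ z : ℤ, Set.EqOn (D^[n] (KahlerStar.divPow u z * G))
      (∑ x ∈ Finset.HasAntidiagonal.antidiagonal n,
        (n.choose x.1 : ℂ) • (KahlerStar.divPow u (z - x.1) * D^[x.2] G)) V := by
  induction n with
  | zero => intro G _ z q _; simp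
  | succ n ih =>
    intro G hG z q hq
    have e : Set.EqOn (D (KahlerStar.divPow u z * G))
        (KahlerStar.divPow u (z - 1) * G + KahlerStar.divPow u z * D G) V := by
      intro x hx
      rw [hD.mul (hu.divPow z) hG hx]
      simp only [Pi.add_apply, Pi.mul_apply]
      rw [hD.divPow hu z hx]
      simp [h1 hx]
    rw [Function.iterate_succ_apply, hD.iterate_congr e n hq,
      hD.iterate_add ((hu.divPow _).mul hG) ((hu.divPow _).mul (hD.smooth hG)) n hq, Pi.add_apply,
      ih hG (z - 1) hq, ih (hD.smooth hG) z hq]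
    simp only [Finset.sum_apply, Pi.smul_apply, Pi.mul_apply, smul_eq_mul]
    rw [Finset.sum_antidiagonal_choose_succ_mul
      (fun i j => KahlerStar.divPow u (z - i) q * D^[j] G q), add_comm]
    congr 1
    · refine Finset.sum_congr rfl fun x hx => ?_
      rw [← Nat.choose_symm_of_eq_add (Finset.HasAntidiagonal.mem_antidiagonal.1 hx).symm]
      push_cast
      rw [sub_sub, add_comm (1 : ℤ)]

end IsDerivationOn

/-- Two derivations `D 0`, `D 1` together with functions `v 0`, `v 1` such that `D k (v l) = δ_kl`. -/
structure IsDualOn (V : Set C2) (D : Fin 2 → (C2 → ℂ) → C2 → ℂ) (v : Fin 2 → C2 → ℂ) : Prop where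
  deriv : ∀ k, IsDerivationOn V (D k)
  smooth : ∀ k, SmoothOn V (v k)
  dual : ∀ k l, Set.EqOn (D k (v l)) (fun _ => if k = l then 1 else 0) V

/-- The monomial `v₀^a v₁^b / (a! b!)`, which is `0` if an exponent is negative. -/
def divMon (v : Fin 2 → C2 → ℂ) (a b : ℤ) : C2 → ℂ := divPow (v 0) a * divPow (v 1) b

theorem divMon_of_neg (v : Fin 2 → C2 → ℂ) {a b : ℤ} (h : a < 0 ∨ b < 0) : divMon v a b = 0 := by
  rcases h with h | h <;> simp [divMon, divPow_of_neg _ h]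

theorem divMon_zero (v : Fin 2 → C2 → ℂ) : divMon v 0 0 = 1 := by
  simp [divMon, divPow_zero]

/-- Together with `IsDualOn.iterate_divMon` this makes the monomials at a common zero dual to the
operators D₀^a D₁^b. Integer exponents, with value 0 when negative, spare all case distinctions on
whether a derivative exceeds the degree. -/
theorem divMon_apply {v : Fin 2 → C2 → ℂ} {p : C2} (hv : ∀ k, v k p = 0) (a b : ℤ) :
    divMon v a b p = if a = 0 ∧ b = 0 then 1 else 0 := by
  simp only [divMon, Pi.mul_apply, divPow_apply_of_eq_zero (hv _)]
  split_ifs <;> simp_all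

theorem mul_divMon_fst (v : Fin 2 → C2 → ℂ) (a b : ℤ) :
    divMon v a b * v 0 = ((a : ℂ) + 1) • divMon v (a + 1) b := by
  rw [divMon, mul_right_comm, mul_comm _ (v 0), mul_divPow, smul_mul_assoc, divMon]

theorem mul_divMon_snd (v : Fin 2 → C2 → ℂ) (a b : ℤ) :
    divMon v a b * v 1 = ((b : ℂ) + 1) • divMon v a (b + 1) := by
  rw [divMon, mul_assoc, mul_comm _ (v 1), mul_divPow, mul_smul_comm, divMon]

theorem IsDerivationOn.divMon {V : Set C2} {E : (C2 → ℂ) → C2 → ℂ} (hE : IsDerivationOn V E)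
    {v : Fin 2 → C2 → ℂ} (hv : ∀ k, SmoothOn V (v k)) (a b : ℤ) :
    Set.EqOn (E (divMon v a b)) (divMon v (a - 1) b * E (v 0) + divMon v a (b - 1) * E (v 1)) V := by
  intro q hq
  rw [KahlerStar.divMon, hE.mul ((hv 0).divPow a) ((hv 1).divPow b) hq]
  simp only [Pi.add_apply, Pi.mul_apply, hE.divPow (hv _) _ hq, KahlerStar.divMon]
  ring

namespace IsDualOn

variable {V : Set C2} {D : Fin 2 → (C2 → ℂ) → C2 → ℂ} {v : Fin 2 → C2 → ℂ}

theorem smooth_divMon (h : IsDualOn V D v) (a b : ℤ) : SmoothOn V (divMon v a b) :=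
  ((h.smooth 0).divPow a).mul ((h.smooth 1).divPow b)

theorem fst_divMon (h : IsDualOn V D v) (a b : ℤ) :
    Set.EqOn (D 0 (divMon v a b)) (divMon v (a - 1) b) V := by
  intro q hq
  rw [(h.deriv 0).divMon h.smooth a b hq]
  simp [h.dual 0 _ hq]

theorem snd_divMon (h : IsDualOn V D v) (a b : ℤ) :
    Set.EqOn (D 1 (divMon v a b)) (divMon v a (b - 1)) V := by
  intro q hq
  rw [(h.deriv 1).divMon h.smooth a b hq]
  simp [h.dual 1 _ hq]

theorem iterate_divMon (h : IsDualOn V D v) (m k : ℕ) (a b : ℤ) :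
    Set.EqOn ((D 0)^[m] ((D 1)^[k] (divMon v a b))) (divMon v (a - m) (b - k)) V := by
  have h1 : ∀ k : ℕ, Set.EqOn ((D 1)^[k] (divMon v a b)) (divMon v a (b - k)) V := by
    intro k
    induction k with
    | zero => intro q _; simp
    | succ k ih =>
      intro q hq
      rw [Function.iterate_succ_apply', (h.deriv 1).congr ih hq, h.snd_divMon _ _ hq]
      push_cast; rw [sub_sub]
  have h2 : ∀ m : ℕ, Set.EqOn ((D 0)^[m] (divMon v a (b - k))) (divMon v (a - m) (b - k)) V := by
    intro m
    induction m with
    | zero => intro q _; simp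
    | succ m ih =>
      intro q hq
      rw [Function.iterate_succ_apply', (h.deriv 0).congr ih hq, h.fst_divMon _ _ hq]
      push_cast; rw [sub_sub]
  exact fun q hq => ((h.deriv 0).iterate_congr (h1 k) m hq).trans (h2 m hq)

/-- In the Leibniz expansion at a common zero, the monomial must absorb exactly a copies of D₀ and b
copies of D₁; the remaining derivatives act on B. -/
theorem iterate_divMon_mul (h : IsDualOn V D v) (m k a b : ℕ) {B : C2 → ℂ} (hB : SmoothOn V B)
    {p : C2} (hp : p ∈ V) (hv : ∀ k, v k p = 0) :
    (D 0)^[m] ((D 1)^[k] (divMon v a b * B)) p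
      = if a ≤ m ∧ b ≤ k then
          (m.choose a : ℂ) * (k.choose b : ℂ) * (D 0)^[m - a] ((D 1)^[k - b] B) p else 0 := by
  have hB' : ∀ j, SmoothOn V ((D 1)^[j] B) := (h.deriv 1).iterate_smooth hB
  have dual0 : Set.EqOn (D 0 (v 0)) (fun _ => 1) V := fun q hq => by simp [h.dual 0 0 hq]
  have dual1 : Set.EqOn (D 1 (v 1)) (fun _ => 1) V := fun q hq => by simp [h.dual 1 1 hq]
  have e1 : Set.EqOn ((D 1)^[k] (divMon v a b * B))
      (∑ y ∈ Finset.HasAntidiagonal.antidiagonal k, (k.choose y.1 : ℂ) •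
        (divPow (v 1) (b - y.1) * (divPow (v 0) a * (D 1)^[y.2] B))) V := by
    intro q hq
    -- The power of v₀ is constant for D₁ and passes through; below, the power of v₁ passes through
    -- D₀ in the same way.
    rw [divMon, mul_assoc, (h.deriv 1).iterate_mul_of_eq_zero ((h.smooth 0).divPow a)
      (((h.smooth 1).divPow b).mul hB) _ k hq, Pi.mul_apply,
      (h.deriv 1).iterate_divPow_mul (h.smooth 1) dual1 k hB b hq]
    · simp only [Finset.sum_apply, Pi.smul_apply, Pi.mul_apply, smul_eq_mul, Finset.mul_sum]
      exact Finset.sum_congr rfl fun _ _ => by ring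
    · intro x hx
      rw [(h.deriv 1).divPow (h.smooth 0) a hx]
      simp [h.dual 1 0 hx]
  have sm : ∀ y : ℕ × ℕ, SmoothOn V (divPow (v 0) a * (D 1)^[y.2] B) := fun y =>
    ((h.smooth 0).divPow a).mul (hB' y.2)
  rw [(h.deriv 0).iterate_congr e1 m hp, (h.deriv 0).iterate_sum
    (fun y _ => (((h.smooth 1).divPow _).mul (sm y)).smul _) m hp, Finset.sum_apply]
  have e2 : ∀ y ∈ Finset.HasAntidiagonal.antidiagonal k, (D 0)^[m] ((k.choose y.1 : ℂ) •
      (divPow (v 1) (b - y.1) * (divPow (v 0) a * (D 1)^[y.2] B))) p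
      = if y.1 = b then (k.choose y.1 : ℂ) *
          ∑ x ∈ Finset.HasAntidiagonal.antidiagonal m, if x.1 = a then
            (m.choose x.1 : ℂ) * (D 0)^[x.2] ((D 1)^[y.2] B) p else 0 else 0 := by
    intro y _
    rw [(h.deriv 0).iterate_smul _ (((h.smooth 1).divPow _).mul (sm y)) m hp, Pi.smul_apply,
      (h.deriv 0).iterate_mul_of_eq_zero ((h.smooth 1).divPow _) (sm y) _ m hp, Pi.mul_apply,
      (h.deriv 0).iterate_divPow_mul (h.smooth 0) dual0 m (hB' _) a hp,
      divPow_apply_of_eq_zero (hv 1)]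
    · simp only [Finset.sum_apply, Pi.smul_apply, Pi.mul_apply, smul_eq_mul,
        divPow_apply_of_eq_zero (hv 0), sub_eq_zero, Nat.cast_inj, eq_comm (a := a),
        eq_comm (a := b)]
      split_ifs
      · rw [one_mul]
        congr 1
        exact Finset.sum_congr rfl fun x _ => by split_ifs <;> simp
      · simp
    · intro x hx
      rw [(h.deriv 0).divPow (h.smooth 1) _ hx]
      simp [h.dual 0 1 hx]
  rw [Finset.sum_congr rfl e2]
  have e3 : ∀ (n c : ℕ) (F : ℕ → ℕ → ℂ), (∑ x ∈ Finset.HasAntidiagonal.antidiagonal n,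
      if x.1 = c then F x.1 x.2 else 0) = if c ≤ n then F c (n - c) else 0 := by
    intro n c F
    rw [Finset.Nat.sum_antidiagonal_eq_sum_range_succ (fun i j => if i = c then F i j else 0)]
    simp
  have e4 : ∀ y : ℕ × ℕ, _ := fun y => e3 m a fun i j =>
    (m.choose i : ℂ) * (D 0)^[j] ((D 1)^[y.2] B) p
  simp only [e4]
  rw [e3 k b (fun i j => (k.choose i : ℂ) *
    if a ≤ m then (m.choose a : ℂ) * (D 0)^[m - a] ((D 1)^[j] B) p else 0)]
  split_ifs <;> simp_all
  ring

/-- Pairing `v₀^c v₁^d B / (c! d!)` with all `D`-monomials of degree `c + d + 2`, at a common zero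
of the dual coordinates: only second derivatives of `B` survive. -/
theorem sum_iterate_divMon_mul (h : IsDualOn V D v) (c d : ℕ) {B : C2 → ℂ} (hB : SmoothOn V B)
    {p : C2} (hp : p ∈ V) (hv : ∀ k, v k p = 0) (τ : ℕ → ℂ) :
    ∑ j ∈ Finset.range (c + d + 2 + 1),
        τ j * (D 0)^[c + d + 2 - j] ((D 1)^[j] (divMon v c d * B)) p
      = ((c + 2).choose 2 : ℂ) * D 0 (D 0 B) p * τ d
        + ((c : ℂ) + 1) * ((d : ℂ) + 1) * D 0 (D 1 B) p * τ (d + 1)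
        + ((d + 2).choose 2 : ℂ) * D 1 (D 1 B) p * τ (d + 2) := by
  -- The monomial uses up c copies of D₀ and d of D₁, so of the c + d + 2 available only two are
  -- left for B; this forces j to be d, d + 1 or d + 2.
  have h0 : ∑ j ∈ Finset.range (c + d + 2 + 1),
        τ j * (D 0)^[c + d + 2 - j] ((D 1)^[j] (divMon v c d * B)) p
      = ∑ j ∈ ({d, d + 1, d + 2} : Finset ℕ),
        τ j * (D 0)^[c + d + 2 - j] ((D 1)^[j] (divMon v c d * B)) p := by
    symm
    refine Finset.sum_subset ?_ ?_
    · intro j hj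
      simp at hj ⊢
      omega
    · intro j hj hj'
      rw [h.iterate_divMon_mul _ _ c d hB hp hv, if_neg, mul_zero]
      simp at hj hj'
      omega
  rw [h0, Finset.sum_insert (by simp), Finset.sum_insert (by simp), Finset.sum_singleton]
  simp only [h.iterate_divMon_mul _ _ c d hB hp hv]
  have a1 : c + d + 2 - d = c + 2 := by omega
  have a2 : c + d + 2 - (d + 1) = c + 1 := by omega
  have a3 : c + d + 2 - (d + 2) = c := by omega
  rw [a1, a2, a3]
  simp only [le_add_iff_nonneg_right, zero_le, le_refl, and_self, if_true, Nat.add_sub_cancel_left,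
    Nat.sub_self, Nat.choose_self, Nat.choose_succ_self_right, Function.iterate_succ,
    Function.iterate_zero, Function.comp, id]
  rw [Nat.choose_symm_of_eq_add (rfl : c + 2 = c + 2), Nat.choose_symm_of_eq_add (rfl : d + 2 = d + 2)]
  push_cast
  ring

end IsDualOn

/-- Used with c k = -w k p, to obtain dual coordinates vanishing at the chosen point p. -/
theorem IsDualOn.sub_const {V : Set C2} {D : Fin 2 → (C2 → ℂ) → C2 → ℂ} {w : Fin 2 → C2 → ℂ}
    (h : IsDualOn V D w) (c : Fin 2 → ℂ) : IsDualOn V D fun k => (fun _ => c k) + w k where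
  deriv := h.deriv
  smooth k := (SmoothOn.const _).add (h.smooth k)
  dual k l q hq := by
    rw [(h.deriv k).add (SmoothOn.const _) (h.smooth l) hq, Pi.add_apply, (h.deriv k).const _ hq,
      h.dual k l hq]
    simp

section

variable {U V : Set C2} {g : C2 → Matrix (Fin 2) (Fin 2) ℂ} {Φ : C2 → ℝ}

theorem IsPotentialOn.isDualOn_DopBar (hg : IsKahlerOn U g) (hV : IsOpen V) (hVU : V ⊆ U)
    (hΦ : IsPotentialOn V g Φ) :
    IsDualOn V (DopBar g) fun k => dzbar k fun q => (Φ q : ℂ) where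
  deriv := isDerivationOn_DopBar hg hV hVU
  smooth k := (isDerivationOn_dzbar hV k).smooth hΦ.smoothOn
  dual k l := hΦ.DopBar_dzbar hg hVU k l

theorem IsPotentialOn.isDualOn_Dop (hg : IsKahlerOn U g) (hV : IsOpen V) (hVU : V ⊆ U)
    (hΦ : IsPotentialOn V g Φ) :
    IsDualOn V (Dop g) fun k => dz k fun q => (Φ q : ℂ) where
  deriv := isDerivationOn_Dop hg hV hVU
  smooth k := (isDerivationOn_dz hV k).smooth hΦ.smoothOn
  dual k l := hΦ.Dop_dz hg hV hVU k l

end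

/-! ### Products with an expansion in the operators `D^k`, `D^k̄` -/

/-- The operator `D₀^a D₁^b`. -/
def iter2 (D : Fin 2 → (C2 → ℂ) → C2 → ℂ) (a b : ℕ) (f : C2 → ℂ) : C2 → ℂ :=
  (D 0)^[a] ((D 1)^[b] f)

section iter2

variable {V : Set C2} {D : Fin 2 → (C2 → ℂ) → C2 → ℂ}

theorem iter2_smooth (hD : ∀ k, IsDerivationOn V (D k)) (a b : ℕ) {f : C2 → ℂ}
    (hf : SmoothOn V f) : SmoothOn V (iter2 D a b f) :=
  (hD 0).iterate_smooth ((hD 1).iterate_smooth hf b) a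

theorem iter2_congr (hD : ∀ k, IsDerivationOn V (D k)) (a b : ℕ) {f h : C2 → ℂ}
    (e : Set.EqOn f h V) : Set.EqOn (iter2 D a b f) (iter2 D a b h) V :=
  (hD 0).iterate_congr ((hD 1).iterate_congr e b) a

theorem iter2_zero (hD : ∀ k, IsDerivationOn V (D k)) (a b : ℕ) :
    Set.EqOn (iter2 D a b 0) 0 V := fun _ hq =>
  ((hD 0).iterate_congr ((hD 1).iterate_zero b) a hq).trans ((hD 0).iterate_zero a hq)

theorem iter2_add (hD : ∀ k, IsDerivationOn V (D k)) (a b : ℕ) {f h : C2 → ℂ}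
    (hf : SmoothOn V f) (hh : SmoothOn V h) :
    Set.EqOn (iter2 D a b (f + h)) (iter2 D a b f + iter2 D a b h) V := fun _ hq =>
  ((hD 0).iterate_congr ((hD 1).iterate_add hf hh b) a hq).trans
    ((hD 0).iterate_add ((hD 1).iterate_smooth hf b) ((hD 1).iterate_smooth hh b) a hq)

theorem iter2_smul (hD : ∀ k, IsDerivationOn V (D k)) (a b : ℕ) (c : ℂ) {f : C2 → ℂ}
    (hf : SmoothOn V f) : Set.EqOn (iter2 D a b (c • f)) (c • iter2 D a b f) V := fun _ hq =>
  ((hD 0).iterate_congr ((hD 1).iterate_smul c hf b) a hq).trans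
    ((hD 0).iterate_smul c ((hD 1).iterate_smooth hf b) a hq)

end iter2

theorem sum_Icc_one_eq_sum_range {M : Type*} [AddCommMonoid M] (n : ℕ) (F : ℕ → M) :
    ∑ i ∈ Finset.Icc 1 (n + 1), F i = ∑ i ∈ Finset.range (n + 1), F (i + 1) := by
  rw [Finset.range_eq_Ico, Finset.sum_Ico_add' F 0 (n + 1) 1]
  rfl

namespace HasExpansionOn

variable {U V : Set C2} {g : C2 → Matrix (Fin 2) (Fin 2) ℂ}
  {C : ℕ → (C2 → ℂ) → (C2 → ℂ) → C2 → ℂ} {T : ℤ → ℤ → ℤ → C2 → ℂ⟦X⟧}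

theorem expand_range (hT : HasExpansionOn U g C T) (k : ℕ) : ∃ N : ℕ,
    (∀ n : ℕ, N ≤ n → ∀ i j : ℤ, ∀ p ∈ U, PowerSeries.coeff k (T n i j p) = 0) ∧
    ∀ V : Set C2, IsOpen V → V ⊆ U → ∀ f h : C2 → ℂ, SmoothOn V f → SmoothOn V h → ∀ p ∈ V,
      C k f h p = ∑ n ∈ Finset.range N,
        ∑ i ∈ Finset.range (n + 1), ∑ j ∈ Finset.range (n + 1),
          PowerSeries.coeff k (T n (i + 1) (j + 1) p)
            * (iter2 (Dop g) (n - i) i f p * iter2 (DopBar g) (n - j) j h p) := by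
  obtain ⟨N, h1, h2⟩ := hT.expand k
  refine ⟨N, h1, fun V hV hVU f h hf hh p hp => ?_⟩
  rw [h2 V hV hVU f h hf hh p hp]
  refine Finset.sum_congr rfl fun n _ => ?_
  rw [sum_Icc_one_eq_sum_range]
  refine Finset.sum_congr rfl fun i _ => ?_
  rw [sum_Icc_one_eq_sum_range]
  refine Finset.sum_congr rfl fun j _ => ?_
  simp only [Nat.add_sub_add_right, Nat.add_sub_cancel, iter2, mul_assoc]
  push_cast
  rfl

section

variable (hg : IsKahlerOn U g) (hT : HasExpansionOn U g C T) (hV : IsOpen V) (hVU : V ⊆ U)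

include hg hT hV hVU

theorem smoothOn_apply (k : ℕ) {f h : C2 → ℂ} (hf : SmoothOn V f) (hh : SmoothOn V h) :
    SmoothOn V (C k f h) := by
  obtain ⟨N, -, h2⟩ := hT.expand_range k
  have : SmoothOn V (∑ n ∈ Finset.range N,
        ∑ i ∈ Finset.range (n + 1), ∑ j ∈ Finset.range (n + 1),
          (fun p => PowerSeries.coeff k (T n (i + 1) (j + 1) p))
            * (iter2 (Dop g) (n - i) i f * iter2 (DopBar g) (n - j) j h)) :=
    SmoothOn.sum fun n _ => SmoothOn.sum fun i _ => SmoothOn.sum fun j _ =>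
      ((hT.smooth _ _ _ _).mono hVU).mul
        ((iter2_smooth (isDerivationOn_Dop hg hV hVU) _ _ hf).mul
          (iter2_smooth (isDerivationOn_DopBar hg hV hVU) _ _ hh))
  refine this.congr fun q hq => ?_
  rw [h2 V hV hVU f h hf hh q hq]
  simp

/-- Functions are total on ℂ² while the identities for products hold only on V; this allows such
identities to be substituted inside another C_k. -/
theorem apply_congr (k : ℕ) {f f' h h' : C2 → ℂ} (hf : SmoothOn V f) (hh : SmoothOn V h)
    (ef : Set.EqOn f' f V) (eh : Set.EqOn h' h V) : Set.EqOn (C k f' h') (C k f h) V := by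
  intro q hq
  obtain ⟨N, -, h2⟩ := hT.expand_range k
  rw [h2 V hV hVU f h hf hh q hq, h2 V hV hVU f' h' (hf.congr ef) (hh.congr eh) q hq]
  simp only [iter2_congr (isDerivationOn_Dop hg hV hVU) _ _ ef hq,
    iter2_congr (isDerivationOn_DopBar hg hV hVU) _ _ eh hq]

theorem apply_zero_right (k : ℕ) {f : C2 → ℂ} (hf : SmoothOn V f) :
    Set.EqOn (C k f 0) 0 V := by
  intro q hq
  obtain ⟨N, -, h2⟩ := hT.expand_range k
  rw [h2 V hV hVU f 0 hf SmoothOn.zero q hq]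
  simp [iter2_zero (isDerivationOn_DopBar hg hV hVU) _ _ hq]

theorem apply_zero_left (k : ℕ) {f : C2 → ℂ} (hf : SmoothOn V f) :
    Set.EqOn (C k 0 f) 0 V := by
  intro q hq
  obtain ⟨N, -, h2⟩ := hT.expand_range k
  rw [h2 V hV hVU 0 f SmoothOn.zero hf q hq]
  simp [iter2_zero (isDerivationOn_Dop hg hV hVU) _ _ hq]

omit hg in
/-- Testing with a monomial in coordinates dual to `D^k` singles out one row of coefficients. -/
theorem apply_divMon {u : Fin 2 → C2 → ℂ} (hu : IsDualOn V (Dop g) u) {p : C2} (hp : p ∈ V)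
    (hu0 : ∀ k, u k p = 0) (k : ℕ) {n i : ℕ} (hi : i ≤ n) {h : C2 → ℂ} (hh : SmoothOn V h) :
    C k (divMon u (n - i) i) h p
      = ∑ j ∈ Finset.range (n + 1), PowerSeries.coeff k (T n (i + 1) (j + 1) p)
          * iter2 (DopBar g) (n - j) j h p := by
  obtain ⟨N, h1, h2⟩ := hT.expand_range k
  rw [h2 V hV hVU _ h (hu.smooth_divMon _ _) hh p hp]
  -- Duality at p: the operators applied to the left argument give a Kronecker delta.
  have e : ∀ n' : ℕ, ∀ i' ∈ Finset.range (n' + 1),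
      iter2 (Dop g) (n' - i') i' (divMon u (n - i) i) p = if n' = n ∧ i' = i then 1 else 0 := by
    intro n' i' hi'
    rw [iter2, hu.iterate_divMon _ _ _ _ hp, divMon_apply hu0]
    simp at hi'
    congr 1
    simp only [eq_iff_iff]
    omega
  have e2 : ∀ n', n' ≠ n → ∑ i' ∈ Finset.range (n' + 1), ∑ j ∈ Finset.range (n' + 1),
      PowerSeries.coeff k (T n' (i' + 1) (j + 1) p)
        * (iter2 (Dop g) (n' - i') i' (divMon u (n - i) i) p
          * iter2 (DopBar g) (n' - j) j h p) = 0 := by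
    intro n' hn'
    refine Finset.sum_eq_zero fun i' hi' => Finset.sum_eq_zero fun j _ => ?_
    rw [e n' i' hi', if_neg (by tauto)]
    simp
  rw [Finset.sum_eq_single n (fun n' _ hn' => e2 n' hn'), Finset.sum_eq_single i]
  · simp [e n i (by simp; omega)]
  · intro i' hi' hne
    refine Finset.sum_eq_zero fun j _ => ?_
    rw [e n i' hi', if_neg (by tauto)]
    simp
  · intro hi'
    simp at hi'
    omega
  · intro hn
    refine Finset.sum_eq_zero fun i' hi' => Finset.sum_eq_zero fun j _ => ?_
    rw [h1 n (by simpa using hn) _ _ p (hVU hp), zero_mul]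

end

end HasExpansionOn

/-- The row index z is an integer because it will be i - κ, which can be -1. Out of range, or beyond
the truncation N, both sides are 0. -/
theorem sum_sum_sum_ite (F : ℤ → ℤ → ℤ → ℂ) (N M m : ℕ) (hm : m ≤ M) (z : ℤ)
    (hz : z < 0 ∨ (M : ℤ) < z → F M (z + 1) (m + 1) = 0)
    (hN : N ≤ M → F M (z + 1) (m + 1) = 0) :
    (∑ n ∈ Finset.range N, ∑ i ∈ Finset.range (n + 1), ∑ j ∈ Finset.range (n + 1),
      if n = M ∧ (i : ℤ) = z ∧ j = m then F n (i + 1) (j + 1) else 0) = F M (z + 1) (m + 1) := by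
  by_cases h : N ≤ M
  · rw [hN h]
    refine Finset.sum_eq_zero fun n hn => Finset.sum_eq_zero fun i _ =>
      Finset.sum_eq_zero fun j _ => if_neg ?_
    simp at hn
    omega
  by_cases h' : z < 0 ∨ (M : ℤ) < z
  · rw [hz h']
    refine Finset.sum_eq_zero fun n hn => Finset.sum_eq_zero fun i hi =>
      Finset.sum_eq_zero fun j _ => if_neg ?_
    simp at hi
    omega
  lift z to ℕ using (by omega)
  rw [Finset.sum_eq_single M, Finset.sum_eq_single z, Finset.sum_eq_single m]
  · simp
  · intro j _ hj; exact if_neg (by tauto)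
  · intro hj; simp at hj; omega
  · intro i _ hi; exact Finset.sum_eq_zero fun j _ => if_neg (by simp; tauto)
  · intro hj; simp at hj; omega
  · intro n _ hn
    exact Finset.sum_eq_zero fun i _ => Finset.sum_eq_zero fun j _ => if_neg (by tauto)
  · intro hj; simp at hj; omega

namespace HasExpansionOn

variable {U V : Set C2} {g : C2 → Matrix (Fin 2) (Fin 2) ℂ}
  {C : ℕ → (C2 → ℂ) → (C2 → ℂ) → C2 → ℂ} {T : ℤ → ℤ → ℤ → C2 → ℂ⟦X⟧}

section

variable (hg : IsKahlerOn U g) (hT : HasExpansionOn U g C T) (hV : IsOpen V) (hVU : V ⊆ U)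
  {u v : Fin 2 → C2 → ℂ} (hu : IsDualOn V (Dop g) u) (hv : IsDualOn V (DopBar g) v)
  {p : C2} (hp : p ∈ V) (hu0 : ∀ k, u k p = 0) (hv0 : ∀ k, v k p = 0)

include hg hT hV hVU hu hv hp hu0 hv0

/-- The derivative of a product of monomials whose degrees differ by one. -/
theorem Dop_apply_divMon (κ : Fin 2) (k : ℕ) {c m i : ℕ} :
    Dop g κ (C k (divMon u (((c + m + 1 : ℕ) : ℤ) - i) i) (divMon v c m)) p
      = PowerSeries.coeff k (T ((c + m : ℕ) : ℤ) ((i : ℤ) - (κ : ℕ) + 1) (m + 1) p) := by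
  obtain ⟨N, h1, h2⟩ := hT.expand_range k
  set f := divMon u (((c + m + 1 : ℕ) : ℤ) - i) i with hf
  set h := divMon v c m with hh
  have hD := isDerivationOn_Dop hg hV hVU κ
  set t : ℕ → ℕ → ℕ → C2 → ℂ := fun n i j q => PowerSeries.coeff k (T n (i + 1) (j + 1) q)
  have st : ∀ n i j, SmoothOn V (t n i j) := fun n i j => (hT.smooth _ _ _ _).mono hVU
  set A : ℕ → ℕ → C2 → ℂ := fun n' i' =>
    divMon u (((c + m + 1 : ℕ) : ℤ) - i - (n' - i' : ℕ)) ((i : ℤ) - i') with hA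
  set B : ℕ → ℕ → C2 → ℂ := fun n' j' =>
    divMon v ((c : ℤ) - (n' - j' : ℕ)) ((m : ℤ) - j') with hB
  have sA : ∀ n i, SmoothOn V (A n i) := fun n i => hu.smooth_divMon _ _
  have sB : ∀ n i, SmoothOn V (B n i) := fun n i => hv.smooth_divMon _ _
  have e : Set.EqOn (C k f h) (∑ n ∈ Finset.range N,
      ∑ i ∈ Finset.range (n + 1), ∑ j ∈ Finset.range (n + 1), t n i j * (A n i * B n j)) V := by
    intro q hq
    rw [h2 V hV hVU f h (hu.smooth_divMon _ _) (hv.smooth_divMon _ _) q hq]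
    simp only [Finset.sum_apply, Pi.mul_apply]
    refine Finset.sum_congr rfl fun n _ => Finset.sum_congr rfl fun i _ =>
      Finset.sum_congr rfl fun j _ => ?_
    rw [iter2, iter2, hu.iterate_divMon _ _ _ _ hq, hv.iterate_divMon _ _ _ _ hq]
  rw [hD.congr e hp, hD.sum (fun n _ => SmoothOn.sum fun i _ => SmoothOn.sum fun j _ =>
    (st n i j).mul ((sA n i).mul (sB n j))) hp, Finset.sum_apply]
  rw [← sum_sum_sum_ite (fun n i j => PowerSeries.coeff k (T n i j p)) N (c + m) m (by omega)
    ((i : ℤ) - (κ : ℕ))]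
  · refine Finset.sum_congr rfl fun n' _ => ?_
    rw [hD.sum (fun i _ => SmoothOn.sum fun j _ =>
      (st n' i j).mul ((sA n' i).mul (sB n' j))) hp, Finset.sum_apply]
    refine Finset.sum_congr rfl fun i' hi' => ?_
    rw [hD.sum (fun j _ => (st n' i' j).mul ((sA n' i').mul (sB n' j))) hp, Finset.sum_apply]
    refine Finset.sum_congr rfl fun j' hj' => ?_
    simp only [Finset.mem_range] at hi' hj'
    rw [hD.mul (st n' i' j') ((sA n' i').mul (sB n' j')) hp, Pi.add_apply, Pi.mul_apply,
      Pi.mul_apply, Pi.mul_apply, hD.mul (sA n' i') (sB n' j') hp, Pi.add_apply, Pi.mul_apply,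
      Pi.mul_apply]
    -- The two factors are nonzero at p only for n' = c + m + 1 and n' = c + m respectively. This
    -- also disposes of the term in which the coefficient T is differentiated.
    have z1 : A n' i' p * B n' j' p = 0 := by
      simp only [hA, hB, divMon_apply hu0, divMon_apply hv0]
      rw [ite_mul, one_mul, zero_mul]
      split_ifs <;> first | rfl | omega
    -- If A does not vanish at p then n' = c + m + 1, and B has total degree -1, hence is
    -- identically 0.
    have z2 : A n' i' p * Dop g κ (B n' j') p = 0 := by
      simp only [hA, hB, divMon_apply hu0]
      split_ifs with hab
      · rw [divMon_of_neg v (by omega), hD.zero hp]; simp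
      · simp
    -- The derivative lowers the degree of A to that of B, so one term survives, with row shifted by
    -- κ.
    have z3 : Dop g κ (A n' i') p * B n' j' p
        = if n' = c + m ∧ (i' : ℤ) = (i : ℤ) - (κ : ℕ) ∧ j' = m then 1 else 0 := by
      fin_cases κ
      · simp only [hA, hB, Fin.zero_eta, hu.fst_divMon _ _ hp, divMon_apply hu0, divMon_apply hv0]
        simp only [mul_ite, mul_one, mul_zero, ← ite_and]
        congr 1
        simp only [eq_iff_iff]
        push_cast
        omega
      · simp only [hA, hB, Fin.mk_one, hu.snd_divMon _ _ hp, divMon_apply hu0, divMon_apply hv0]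
        simp only [mul_ite, mul_one, mul_zero, ← ite_and]
        congr 1
        simp only [eq_iff_iff]
        push_cast
        omega
    rw [z1, z2, z3]
    split_ifs <;> simp [t]
  · intro hz
    rw [hT.outside _ _ _ (by push_cast at hz ⊢; omega) p (hVU hp), map_zero]
  · intro hN
    rw [h1 _ hN _ _ p (hVU hp)]

end

end HasExpansionOn

/-- The properties of Karabegov's star product of a Kähler form, expressed through the operators
`C_k` on smooth functions, that determine its expansion coefficients. -/
structure IsKarabegovProductOn (U : Set C2) (g : C2 → Matrix (Fin 2) (Fin 2) ℂ)
    (C : ℕ → (C2 → ℂ) → (C2 → ℂ) → C2 → ℂ) : Prop where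
  assoc : ∀ V : Set C2, IsOpen V → V ⊆ U → ∀ f h w : C2 → ℂ, SmoothOn V f → SmoothOn V h →
    SmoothOn V w → ∀ m : ℕ, ∀ p ∈ V,
      ∑ x ∈ Finset.HasAntidiagonal.antidiagonal m, C x.1 f (C x.2 h w) p
        = ∑ x ∈ Finset.HasAntidiagonal.antidiagonal m, C x.1 (C x.2 f h) w p
  mul_one : ∀ V : Set C2, IsOpen V → V ⊆ U → ∀ f : C2 → ℂ, SmoothOn V f → ∀ k : ℕ, ∀ p ∈ V,
    C k f 1 p = if k = 0 then f p else 0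
  normalized : ∀ V : Set C2, IsOpen V → V ⊆ U → ∀ Φ : C2 → ℝ, IsPotentialOn V g Φ →
    ∀ f : C2 → ℂ, SmoothOn V f → ∀ l : Fin 2, ∀ p ∈ V,
      C 0 f (dzbar l fun q => (Φ q : ℂ)) p = dzbar l (fun q => (Φ q : ℂ)) p * f p ∧
      C 1 f (dzbar l fun q => (Φ q : ℂ)) p = dzbar l f p ∧
      ∀ k, C (k + 2) f (dzbar l fun q => (Φ q : ℂ)) p = 0

/-! ### Associativity with ∂_l̄ Φ, tested on monomials. -/

namespace IsKarabegovProductOn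

variable {U V : Set C2} {g : C2 → Matrix (Fin 2) (Fin 2) ℂ} {Φ : C2 → ℝ}
  {C : ℕ → (C2 → ℂ) → (C2 → ℂ) → C2 → ℂ} {T : ℤ → ℤ → ℤ → C2 → ℂ⟦X⟧}

section

variable (hC : IsKarabegovProductOn U g C) (hg : IsKahlerOn U g) (hT : HasExpansionOn U g C T)
  (hV : IsOpen V) (hVU : V ⊆ U) (hΦ : IsPotentialOn V g Φ)

include hC hg hT hV hVU hΦ

theorem zeroth_mul_potential {f h : C2 → ℂ} (hf : SmoothOn V f) (hh : SmoothOn V h) (l : Fin 2)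
    {q : C2} (hq : q ∈ V) :
    C 0 f (h * dzbar l fun q => (Φ q : ℂ)) q
      = dzbar l (fun q => (Φ q : ℂ)) q * C 0 f h q := by
  have hψ : SmoothOn V (dzbar l fun q => (Φ q : ℂ)) :=
    (isDerivationOn_dzbar hV l).smooth hΦ.smoothOn
  have := hC.assoc V hV hVU f h _ hf hh hψ 0 q hq
  simp only [Finset.HasAntidiagonal.antidiagonal_zero, Finset.sum_singleton] at this
  rw [(hC.normalized V hV hVU Φ hΦ _ (hT.smoothOn_apply hg hV hVU 0 hf hh) l q hq).1] at this
  rw [← this]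
  refine hT.apply_congr hg hV hVU 0 hf (hT.smoothOn_apply hg hV hVU 0 hh hψ) (fun _ _ => rfl)
    (fun x hx => ?_) hq
  rw [(hC.normalized V hV hVU Φ hΦ _ hh l x hx).1, Pi.mul_apply, mul_comm]

/-- Coefficient of ħ^(k+1) in f ∗ (h ∗ ∂_l̄Φ) = (f ∗ h) ∗ ∂_l̄Φ. By normalization, right
multiplication by ∂_l̄Φ has only the orders 0 and 1, so two terms survive on each side. -/
theorem succ_mul_potential {f h : C2 → ℂ} (hf : SmoothOn V f) (hh : SmoothOn V h) (l : Fin 2)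
    (k : ℕ) {q : C2} (hq : q ∈ V) :
    C (k + 1) f (h * dzbar l fun q => (Φ q : ℂ)) q + C k f (dzbar l h) q
      = dzbar l (fun q => (Φ q : ℂ)) q * C (k + 1) f h q + dzbar l (C k f h) q := by
  have hψ : SmoothOn V (dzbar l fun q => (Φ q : ℂ)) :=
    (isDerivationOn_dzbar hV l).smooth hΦ.smoothOn
  have hfh : ∀ k, SmoothOn V (C k f h) := fun k => hT.smoothOn_apply hg hV hVU k hf hh
  have := hC.assoc V hV hVU f h _ hf hh hψ (k + 1) q hq
  have e0 : C (k + 1) f (C 0 h (dzbar l fun q => (Φ q : ℂ))) q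
      = C (k + 1) f (h * dzbar l fun q => (Φ q : ℂ)) q :=
    (hT.apply_congr hg hV hVU _ hf (hh.mul hψ) (fun _ _ => rfl) (fun x hx => by
      rw [(hC.normalized V hV hVU Φ hΦ _ hh l x hx).1, Pi.mul_apply, mul_comm]) hq)
  have e1 : C k f (C 1 h (dzbar l fun q => (Φ q : ℂ))) q = C k f (dzbar l h) q :=
    (hT.apply_congr hg hV hVU _ hf ((isDerivationOn_dzbar hV l).smooth hh) (fun _ _ => rfl)
      (fun x hx => (hC.normalized V hV hVU Φ hΦ _ hh l x hx).2.1) hq)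
  have e2 : ∀ a b, C a f (C (b + 2) h (dzbar l fun q => (Φ q : ℂ))) q = 0 := fun a b =>
    (hT.apply_congr hg hV hVU a hf SmoothOn.zero (fun _ _ => rfl)
      (fun x hx => (hC.normalized V hV hVU Φ hΦ _ hh l x hx).2.2 b) hq).trans
      (hT.apply_zero_right hg hV hVU a hf hq)
  rw [Finset.Nat.sum_antidiagonal_eq_sum_range_succ_mk, Finset.sum_range_succ,
    Finset.sum_range_succ, Finset.sum_eq_zero, Finset.Nat.sum_antidiagonal_eq_sum_range_succ_mk,
    Finset.sum_range_succ', Finset.sum_range_succ', Finset.sum_eq_zero] at this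
  · simp only [Nat.sub_self, Nat.add_sub_cancel_left, e0, e1, zero_add, Nat.sub_zero,
      Nat.add_sub_cancel, (hC.normalized V hV hVU Φ hΦ _ (hfh _) l q hq).1,
      (hC.normalized V hV hVU Φ hΦ _ (hfh _) l q hq).2.1] at this
    rw [add_comm, this, add_comm]
  · intro a _
    exact (hC.normalized V hV hVU Φ hΦ _ (hfh _) l q hq).2.2 a
  · intro a ha
    simp only [Finset.mem_range] at ha
    obtain ⟨b, hb⟩ : ∃ b, k + 1 - a = b + 2 := ⟨k - 1 - a, by omega⟩
    simp only [hb]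
    exact e2 a b

variable {p : C2} (hp : p ∈ V) {c m i : ℕ} (hi : i ≤ c + m + 1)

include hp hi

/-- The coefficientwise recursion obtained by testing the star product with monomials in
`∂_k Φ` and `∂_l̄ Φ`. -/
theorem recursion_aux (l : Fin 2) (τ : ℕ → ℕ → ℂ)
    (hτ : ∀ k j, τ k j = PowerSeries.coeff k (T ((c + m + 1 : ℕ) : ℤ) (i + 1) (j + 1) p)) :
    (if l = 0 then ((c : ℂ) + 1) * τ 0 m else ((m : ℂ) + 1) * τ 0 (m + 1)) = 0 ∧
    ∀ k, (if l = 0 then ((c : ℂ) + 1) * τ (k + 1) m else ((m : ℂ) + 1) * τ (k + 1) (m + 1))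
      + (((c + 1).choose 2 : ℂ) * curv g l 0 0 0 p * τ k m
        + (c : ℂ) * ((m : ℂ) + 1) * curv g l 0 1 0 p * τ k (m + 1)
        + ((m + 2).choose 2 : ℂ) * curv g l 1 1 0 p * τ k (m + 2)
        + (((c + 2).choose 2 : ℂ) * curv g l 0 0 1 p *
            PowerSeries.coeff k (T ((c + m + 1 : ℕ) : ℤ) (i + 1) m p)
        + ((c : ℂ) + 1) * (m : ℂ) * curv g l 0 1 1 p * τ k m
        + ((m + 1).choose 2 : ℂ) * curv g l 1 1 1 p * τ k (m + 1)))
      = g p 0 l * PowerSeries.coeff k (T ((c + m : ℕ) : ℤ) (i + 1) (m + 1) p)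
        + g p 1 l * PowerSeries.coeff k (T ((c + m : ℕ) : ℤ) i (m + 1) p) := by
  set ψ : Fin 2 → C2 → ℂ := fun k => dzbar k fun q => (Φ q : ℂ) with hψ
  set v : Fin 2 → C2 → ℂ := fun k => (fun _ => -ψ k p) + ψ k with hv_def
  set u : Fin 2 → C2 → ℂ :=
    fun k => (fun _ => -dz k (fun q => (Φ q : ℂ)) p) + dz k fun q => (Φ q : ℂ) with hu_def
  have hv : IsDualOn V (DopBar g) v := (hΦ.isDualOn_DopBar hg hV hVU).sub_const _
  have hu : IsDualOn V (Dop g) u := (hΦ.isDualOn_Dop hg hV hVU).sub_const _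
  have hv0 : ∀ k, v k p = 0 := fun k => by simp [hv_def]
  have hu0 : ∀ k, u k p = 0 := fun k => by simp [hu_def]
  set f := divMon u (((c + m + 1 : ℕ) : ℤ) - i) i with hf_def
  set h := divMon v c m with hh_def
  have hf : SmoothOn V f := hu.smooth_divMon _ _
  have hh : SmoothOn V h := hv.smooth_divMon _ _
  have hDB := isDerivationOn_DopBar hg hV hVU
  have row : ∀ k, ∀ w, SmoothOn V w → C k f w p = ∑ j ∈ Finset.range (c + m + 1 + 1),
      τ k j * iter2 (DopBar g) (c + m + 1 - j) j w p := by
    intro k w hw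
    simp only [hτ]
    exact hT.apply_divMon hV hVU hu hp hu0 k hi hw
  have iter_h : ∀ j ∈ Finset.range (c + m + 1 + 1),
      iter2 (DopBar g) (c + m + 1 - j) j h p = 0 := by
    intro j hj
    simp only [Finset.mem_range] at hj
    rw [iter2, hv.iterate_divMon _ _ _ _ hp, divMon_apply hv0, if_neg (by omega)]
  -- The degree of f selects operators of order c + m + 1 on h, whose degree is only c + m.
  have apply_h : ∀ k, C k f h p = 0 := by
    intro k
    rw [row k h hh]
    exact Finset.sum_eq_zero fun j hj => by rw [iter_h j hj, mul_zero]
  have apply_mul : ∀ k, C k f (h * ψ l) p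
      = if l = 0 then ((c : ℂ) + 1) * τ k m else ((m : ℂ) + 1) * τ k (m + 1) := by
    intro k
    have split : ∀ (α : ℂ) (w : C2 → ℂ) (j₀ : ℕ), j₀ ∈ Finset.range (c + m + 1 + 1) →
        SmoothOn V w → h * v l = α • w →
        (∀ j ∈ Finset.range (c + m + 1 + 1),
          iter2 (DopBar g) (c + m + 1 - j) j w p = if j = j₀ then 1 else 0) →
        C k f (h * ψ l) p = α * τ k j₀ := by
      intro α w j₀ hj₀ hw e1 e2
      -- Here ψ l = v l + ψ l p; the constant part multiplies h, which contributes nothing at p.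
      have e : h * ψ l = α • w + ψ l p • h := by
        rw [← e1]
        ext q
        simp [hv_def]
        ring
      rw [row k _ (hh.mul ((isDerivationOn_dzbar hV l).smooth hΦ.smoothOn)), e]
      have : ∀ j ∈ Finset.range (c + m + 1 + 1),
          τ k j * iter2 (DopBar g) (c + m + 1 - j) j (α • w + ψ l p • h) p
            = if j = j₀ then α * τ k j else 0 := by
        intro j hj
        rw [iter2_add hDB _ _ (hw.smul _) (hh.smul _) hp, Pi.add_apply,
          iter2_smul hDB _ _ _ hw hp, iter2_smul hDB _ _ _ hh hp, Pi.smul_apply, Pi.smul_apply,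
          iter_h j hj, e2 j hj]
        split_ifs <;> simp [mul_comm]
      rw [Finset.sum_congr rfl this, Finset.sum_ite_eq', if_pos hj₀]
    fin_cases l
    · refine split _ (divMon v (c + 1) m) m (by simp; omega) (hv.smooth_divMon _ _) ?_ ?_
      · exact (mul_divMon_fst v c m).trans (by simp)
      · intro j hj
        simp only [Finset.mem_range] at hj
        rw [iter2, hv.iterate_divMon _ _ _ _ hp, divMon_apply hv0]
        congr 1
        simp only [eq_iff_iff]
        omega
    · refine split _ (divMon v c (m + 1)) (m + 1) (by simp) (hv.smooth_divMon _ _) ?_ ?_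
      · exact (mul_divMon_snd v c m).trans (by simp)
      · intro j hj
        simp only [Finset.mem_range] at hj
        rw [iter2, hv.iterate_divMon _ _ _ _ hp, divMon_apply hv0]
        congr 1
        simp only [eq_iff_iff]
        omega
  have dzbar_v : ∀ b, Set.EqOn (dzbar l (v b)) (dzbar l (dzbar b fun q => (Φ q : ℂ))) V := by
    intro b q hq
    rw [(isDerivationOn_dzbar hV l).add (SmoothOn.const _)
      ((isDerivationOn_dzbar hV b).smooth hΦ.smoothOn) hq, Pi.add_apply,
      (isDerivationOn_dzbar hV l).const _ hq]
    simp
  have DDB : ∀ a a' b, DopBar g a (DopBar g a' (dzbar l (v b))) p = curv g l a a' b p := by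
    intro a a' b
    rw [(hDB a).congr ((hDB a').congr (dzbar_v b)) hp]
    exact hΦ.DopBar_DopBar_eq_curv hg hV hVU l a a' b hp
  have sB : ∀ b, SmoothOn V (dzbar l (v b)) := fun b =>
    (isDerivationOn_dzbar hV l).smooth (hv.smooth b)
  have out : ∀ k (j : ℤ), j = 0 ∨ j = c + m + 3 →
      PowerSeries.coeff k (T ((c + m + 1 : ℕ) : ℤ) (i + 1) j p) = 0 := by
    intro k j hj
    rw [hT.outside _ _ _ (by push_cast; omega) p (hVU hp), map_zero]
  have fst_part : ∀ k, ∑ j ∈ Finset.range (c + m + 1 + 1),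
      τ k j * iter2 (DopBar g) (c + m + 1 - j) j (divMon v ((c : ℤ) - 1) m * dzbar l (v 0)) p
      = ((c + 1).choose 2 : ℂ) * curv g l 0 0 0 p * τ k m
        + (c : ℂ) * ((m : ℂ) + 1) * curv g l 0 1 0 p * τ k (m + 1)
        + ((m + 2).choose 2 : ℂ) * curv g l 1 1 0 p * τ k (m + 2) := by
    intro k
    clear_value f h v
    rcases c with _ | c
    · have h0 : τ k (m + 2) = 0 := by
        rw [hτ]; exact out k _ (by push_cast; omega)
      rw [divMon_of_neg v (by simp), zero_mul, h0]
      simp [iter2_zero hDB _ _ hp]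
    · have := hv.sum_iterate_divMon_mul c m (sB 0) hp hv0 (τ k)
      simp only [DDB] at this
      have e : ((c + 1 : ℕ) : ℤ) - 1 = c := by push_cast; ring
      have e' : c + 1 + m + 1 = c + m + 2 := by ring
      rw [e, e']
      simp only [iter2]
      rw [this]
      push_cast
      ring
  have snd_part : ∀ k, ∑ j ∈ Finset.range (c + m + 1 + 1),
      τ k j * iter2 (DopBar g) (c + m + 1 - j) j (divMon v c ((m : ℤ) - 1) * dzbar l (v 1)) p
      = ((c + 2).choose 2 : ℂ) * curv g l 0 0 1 p *
            PowerSeries.coeff k (T ((c + m + 1 : ℕ) : ℤ) (i + 1) m p)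
        + ((c : ℂ) + 1) * (m : ℂ) * curv g l 0 1 1 p * τ k m
        + ((m + 1).choose 2 : ℂ) * curv g l 1 1 1 p * τ k (m + 1) := by
    intro k
    clear_value f h v
    rcases m with _ | m
    -- For m = 0 the first term involves column 0, which is 0 by convention.
    · rw [divMon_of_neg v (by simp), zero_mul, out k _ (by simp)]
      simp [iter2_zero hDB _ _ hp]
    · have := hv.sum_iterate_divMon_mul c m (sB 1) hp hv0 (τ k)
      simp only [DDB] at this
      have e : ((m + 1 : ℕ) : ℤ) - 1 = m := by push_cast; ring
      have e' : c + (m + 1) + 1 = c + m + 2 := by ring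
      have e'' : PowerSeries.coeff k (T ((c + (m + 1) + 1 : ℕ) : ℤ) (i + 1) ((m + 1 : ℕ) : ℤ) p)
          = τ k m := by
        rw [hτ]; push_cast; rfl
      rw [e'', e, e']
      simp only [iter2]
      rw [this]
      push_cast
      ring
  have sdiv : ∀ a b, SmoothOn V (divMon v a b) := hv.smooth_divMon
  have apply_dzbar : ∀ k, C k f (dzbar l h) p =
      ∑ j ∈ Finset.range (c + m + 1 + 1),
        τ k j * iter2 (DopBar g) (c + m + 1 - j) j (divMon v ((c : ℤ) - 1) m * dzbar l (v 0)) p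
      + ∑ j ∈ Finset.range (c + m + 1 + 1),
        τ k j * iter2 (DopBar g) (c + m + 1 - j) j
          (divMon v c ((m : ℤ) - 1) * dzbar l (v 1)) p := by
    intro k
    rw [row k _ ((isDerivationOn_dzbar hV l).smooth hh)]
    have : ∀ j ∈ Finset.range (c + m + 1 + 1),
        τ k j * iter2 (DopBar g) (c + m + 1 - j) j (dzbar l h) p
        = τ k j * iter2 (DopBar g) (c + m + 1 - j) j (divMon v ((c : ℤ) - 1) m * dzbar l (v 0)) p
          + τ k j * iter2 (DopBar g) (c + m + 1 - j) j
            (divMon v c ((m : ℤ) - 1) * dzbar l (v 1)) p := by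
      intro j _
      rw [iter2_congr hDB _ _ ((isDerivationOn_dzbar hV l).divMon hv.smooth c m) hp,
        iter2_add hDB _ _ ((sdiv _ _).mul (sB 0)) ((sdiv _ _).mul (sB 1)) hp, Pi.add_apply,
        mul_add]
    rw [Finset.sum_congr rfl this, Finset.sum_add_distrib]
  constructor
  · rw [← apply_mul, hC.zeroth_mul_potential hg hT hV hVU hΦ hf hh l hp, apply_h, mul_zero]
  · intro k
    rw [← apply_mul, ← fst_part, ← snd_part, ← apply_dzbar, hC.succ_mul_potential hg hT hV hVU hΦ hf hh l k hp, apply_h,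
      mul_zero, zero_add, dzbar_eq_sum_Dop (hg.posDef p (hVU hp)), Fin.sum_univ_two,
      hT.Dop_apply_divMon hg hV hVU hu hv hp hu0 hv0,
      hT.Dop_apply_divMon hg hV hVU hu hv hp hu0 hv0]
    simp

end

end IsKarabegovProductOn

/-! ### The full recursion and its uniqueness -/

/-- The recursion for the expansion coefficients `T` at the point `p`, obtained by comparing the
terms of bidegree `(c + m + 1, c + m)` in `[L_f, R_{∂_l̄ Φ}] = 0`. -/
def SatisfiesRecursion (g : C2 → Matrix (Fin 2) (Fin 2) ℂ) (p : C2)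
    (T : ℤ → ℤ → ℤ → C2 → ℂ⟦X⟧) : Prop :=
  ∀ (l : Fin 2) (c m i : ℕ), i ≤ c + m + 1 → ∀ τ : ℤ → ℂ⟦X⟧,
    (∀ j, τ j = T ((c + m + 1 : ℕ) : ℤ) (i + 1) j p) →
    (if l = 0 then ((c : ℂ) + 1) • τ (m + 1) else ((m : ℂ) + 1) • τ (m + 2))
      + PowerSeries.X * ((((c + 1).choose 2 : ℂ) * curv g l 0 0 0 p) • τ (m + 1)
        + ((c : ℂ) * ((m : ℂ) + 1) * curv g l 0 1 0 p) • τ (m + 2)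
        + (((m + 2).choose 2 : ℂ) * curv g l 1 1 0 p) • τ (m + 3)
        + ((((c + 2).choose 2 : ℂ) * curv g l 0 0 1 p) • τ m
        + (((c : ℂ) + 1) * (m : ℂ) * curv g l 0 1 1 p) • τ (m + 1)
        + (((m + 1).choose 2 : ℂ) * curv g l 1 1 1 p) • τ (m + 2)))
      = PowerSeries.X * (g p 0 l • T ((c + m : ℕ) : ℤ) (i + 1) (m + 1) p
        + g p 1 l • T ((c + m : ℕ) : ℤ) i (m + 1) p)

namespace IsKarabegovProductOn

variable {U V : Set C2} {g : C2 → Matrix (Fin 2) (Fin 2) ℂ}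
  {C : ℕ → (C2 → ℂ) → (C2 → ℂ) → C2 → ℂ} {T : ℤ → ℤ → ℤ → C2 → ℂ⟦X⟧}

/-- The potential used in the derivation is only local, but the recursion at p mentions it no
longer. -/
theorem satisfiesRecursion (hC : IsKarabegovProductOn U g C) (hg : IsKahlerOn U g)
    (hT : HasExpansionOn U g C T) {p : C2} (hp : p ∈ U) : SatisfiesRecursion g p T := by
  obtain ⟨V, hV, hpV, hVU, Φ, hΦ⟩ := hg.potential p hp
  intro l c m i hi τ hτ
  have := hC.recursion_aux hg hT hV hVU hΦ hpV hi l _ (fun _ _ => rfl)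
  have e2 : ((m + 1 : ℕ) : ℤ) + 1 = m + 2 := by push_cast; ring
  have e3 : ((m + 2 : ℕ) : ℤ) + 1 = m + 3 := by push_cast; ring
  simp only [e2, e3, ← hτ] at this
  ext k
  rcases k with _ | k
  · have h0 := this.1
    rw [map_add, PowerSeries.coeff_zero_X_mul, PowerSeries.coeff_zero_X_mul, add_zero, ← h0]
    split_ifs <;> simp
  · have hk := this.2 k
    rw [map_add, PowerSeries.coeff_succ_X_mul, PowerSeries.coeff_succ_X_mul]
    simp only [map_add, PowerSeries.coeff_smul, smul_eq_mul]
    rw [← hk]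
    congr 1
    split_ifs <;> simp

/-- The coefficient of lowest order is `1`. -/
theorem coeff_zero_eq_one (hC : IsKarabegovProductOn U g C) (hg : IsKahlerOn U g)
    (hT : HasExpansionOn U g C T) {p : C2} (hp : p ∈ U) : T 0 1 1 p = 1 := by
  obtain ⟨V, hV, hpV, hVU, Φ, hΦ⟩ := hg.potential p hp
  have hu := (hΦ.isDualOn_Dop hg hV hVU).sub_const fun k => -dz k (fun q => (Φ q : ℂ)) p
  ext k
  have h1 := hC.mul_one V hV hVU 1 SmoothOn.one k p hpV
  have h2 := hT.apply_divMon hV hVU hu hpV (fun k => by simp) k (n := 0) (i := 0) le_rfl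
    (h := 1) SmoothOn.one
  simp [divMon_zero, iter2] at h2
  rw [← h2, h1, PowerSeries.coeff_one]
  simp

/-- The coefficients of first order are `ħ g_{k l̄}`. -/
theorem coeff_one_eq (hC : IsKarabegovProductOn U g C) (hg : IsKahlerOn U g)
    (hT : HasExpansionOn U g C T) {p : C2} (hp : p ∈ U) (k l : Fin 2) :
    T 1 ((k : ℕ) + 1) ((l : ℕ) + 1) p = PowerSeries.X * PowerSeries.C (g p k l) := by
  have h0 := hC.coeff_zero_eq_one hg hT hp
  have hout : ∀ i j : ℤ, ¬ (i = 1 ∧ j = 1) → T 0 i j p = 0 := fun i j h =>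
    hT.outside _ _ _ (by omega) p hp
  have hout1 : ∀ i j : ℤ, j < 1 ∨ 2 < j → T 1 i j p = 0 := fun i j h =>
    hT.outside _ _ _ (by omega) p hp
  -- For c = m = 0 every curvature term has a zero coefficient or a column outside the 2 × 2 matrix.
  have := hC.satisfiesRecursion hg hT hp l 0 0 k (by omega) _ (fun _ => rfl)
  fin_cases k <;> fin_cases l <;>
    simpa [h0, hout, hout1, PowerSeries.smul_eq_C_mul] using this

end IsKarabegovProductOn

/-- The recursion determines the coefficients from those of lowest order. -/
theorem SatisfiesRecursion.unique {g : C2 → Matrix (Fin 2) (Fin 2) ℂ} {p : C2}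
    {T T' : ℤ → ℤ → ℤ → C2 → ℂ⟦X⟧} (h : SatisfiesRecursion g p T)
    (h' : SatisfiesRecursion g p T')
    (hout : ∀ n i j : ℤ, ¬ (0 ≤ n ∧ 1 ≤ i ∧ i ≤ n + 1 ∧ 1 ≤ j ∧ j ≤ n + 1) →
      T n i j p = T' n i j p)
    (h0 : T 0 1 1 p = T' 0 1 1 p) (n i j : ℤ) : T n i j p = T' n i j p := by
  by_cases hn : 0 ≤ n
  swap
  · exact hout n i j (by tauto)
  lift n to ℕ using hn
  induction n generalizing i j with
  | zero =>
    by_cases hij : i = 1 ∧ j = 1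
    · rw [hij.1, hij.2]; exact h0
    · exact hout _ i j (by push_cast; omega)
  | succ n ih =>
    by_cases hr : 1 ≤ i ∧ i ≤ n + 2 ∧ 1 ≤ j ∧ j ≤ n + 2
    swap
    · exact hout _ i j (by push_cast; omega)
    obtain ⟨i, rfl⟩ : ∃ i' : ℕ, i = i' + 1 := ⟨(i - 1).toNat, by omega⟩
    have hi : i ≤ n + 1 := by omega
    -- Induction on the power of ħ, for all columns at once: the curvature terms involve
    -- neighbouring columns, but carry an extra factor ħ.
    suffices H : ∀ k, ∀ j : ℤ, PowerSeries.coeff k (T ((n + 1 : ℕ) : ℤ) (i + 1) j p)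
        = PowerSeries.coeff k (T' ((n + 1 : ℕ) : ℤ) (i + 1) j p) by
      ext k; exact H k j
    clear hr j
    intro k
    induction k using Nat.strong_induction_on with
    | _ k ihk =>
      have step : ∀ (l : Fin 2) (c m : ℕ), c + m = n →
          PowerSeries.coeff k (T ((n + 1 : ℕ) : ℤ) (i + 1) (if l = 0 then m + 1 else m + 2) p)
            = PowerSeries.coeff k
              (T' ((n + 1 : ℕ) : ℤ) (i + 1) (if l = 0 then m + 1 else m + 2) p) := by
        intro l c m hcm
        subst hcm
        have e := h l c m i hi _ (fun _ => rfl)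
        have e' := h' l c m i hi _ (fun _ => rfl)
        rw [ih, ih, ← e'] at e
        have e := congrArg (PowerSeries.coeff k) e
        have hc : (c : ℂ) + 1 ≠ 0 := Nat.cast_add_one_ne_zero c
        have hm : (m : ℂ) + 1 ≠ 0 := Nat.cast_add_one_ne_zero m
        rcases k with _ | k
        · simp only [map_add, PowerSeries.coeff_zero_X_mul, add_zero] at e
          split_ifs at e ⊢
          · simpa [hc] using e
          · simpa [hm] using e
        · simp only [map_add, PowerSeries.coeff_succ_X_mul, PowerSeries.coeff_smul,
            ihk k (Nat.lt_succ_self k), add_left_inj] at e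
          split_ifs at e ⊢
          · simpa [hc] using e
          · simpa [hm] using e
      intro j
      -- The instances l = 0 lead with columns 1 to n + 1; the last column n + 2 needs l = 1 with c
      -- = 0 and m = n.
      by_cases hj : 1 ≤ j ∧ j ≤ n + 1
      · obtain ⟨m, rfl⟩ : ∃ m : ℕ, j = m + 1 := ⟨(j - 1).toNat, by omega⟩
        simpa using step 0 (n - m) m (by omega)
      by_cases hj' : j = n + 2
      · subst hj'
        simpa using step 1 0 n (by omega)
      · rw [hout _ _ j (by push_cast; omega)]

/-! ### The conjugate opposite product -/

/-- The product `(f, h) ↦ conj (conj h ∗ conj f)`. -/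
def conjOp (C : ℕ → (C2 → ℂ) → (C2 → ℂ) → C2 → ℂ) : ℕ → (C2 → ℂ) → (C2 → ℂ) → C2 → ℂ :=
  fun k f h => star (C k (star h) (star f))

/-- The coefficients `conj T^n_{ji}`. -/
def conjCoeff (T : ℤ → ℤ → ℤ → C2 → ℂ⟦X⟧) : ℤ → ℤ → ℤ → C2 → ℂ⟦X⟧ :=
  fun n i j p => PowerSeries.map (starRingEnd ℂ) (T n j i p)

section

variable {U V : Set C2} {g : C2 → Matrix (Fin 2) (Fin 2) ℂ} {Φ : C2 → ℝ}
  {C : ℕ → (C2 → ℂ) → (C2 → ℂ) → C2 → ℂ} {T : ℤ → ℤ → ℤ → C2 → ℂ⟦X⟧}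

theorem iterate_star {D E : (C2 → ℂ) → C2 → ℂ} (hD : IsDerivationOn V D)
    (e : ∀ f, Set.EqOn (D (star f)) (star (E f)) V) (n : ℕ) (f : C2 → ℂ) :
    Set.EqOn (D^[n] (star f)) (star (E^[n] f)) V := by
  induction n with
  | zero => intro _ _; rfl
  | succ n ih =>
    intro q hq
    rw [Function.iterate_succ_apply', Function.iterate_succ_apply', hD.congr ih hq, e _ hq]

theorem iter2_Dop_star (hg : IsKahlerOn U g) (hV : IsOpen V) (hVU : V ⊆ U) (a b : ℕ)
    (f : C2 → ℂ) : Set.EqOn (iter2 (Dop g) a b (star f)) (star (iter2 (DopBar g) a b f)) V := by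
  have hD := isDerivationOn_Dop hg hV hVU
  have e : ∀ k f, Set.EqOn (Dop g k (star f)) (star (DopBar g k f)) V :=
    fun k f q hq => Dop_star (hg.posDef q (hVU hq)) k f
  intro q hq
  rw [iter2, (hD 0).iterate_congr (iterate_star (hD 1) (e 1) b f) a hq,
    iterate_star (hD 0) (e 0) a _ hq]
  rfl

theorem iter2_DopBar_star (hg : IsKahlerOn U g) (hV : IsOpen V) (hVU : V ⊆ U) (a b : ℕ)
    (f : C2 → ℂ) : Set.EqOn (iter2 (DopBar g) a b (star f)) (star (iter2 (Dop g) a b f)) V := by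
  intro q hq
  have := iter2_Dop_star hg hV hVU a b (star f) hq
  rw [star_star] at this
  rw [Pi.star_apply, this, Pi.star_apply, star_star]

theorem HasExpansionOn.conjOp (hT : HasExpansionOn U g C T) (hg : IsKahlerOn U g) :
    HasExpansionOn U g (conjOp C) (conjCoeff T) where
  smooth n i j k := by
    refine (hT.smooth n j i k).conj.congr fun q _ => ?_
    simp [conjCoeff]
  outside n i j h p hp := by
    rw [conjCoeff, hT.outside n j i (by tauto) p hp, map_zero]
  expand k := by
    obtain ⟨N, h1, h2⟩ := hT.expand_range k
    refine ⟨N, fun n hn i j p hp => ?_, fun V hV hVU f h hf hh p hp => ?_⟩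
    · rw [conjCoeff, PowerSeries.coeff_map, h1 n hn j i p hp, map_zero]
    · rw [KahlerStar.conjOp, Pi.star_apply, h2 V hV hVU _ _ hh.conj hf.conj p hp]
      simp only [star_sum, star_mul', iter2_Dop_star hg hV hVU _ _ _ hp,
        iter2_DopBar_star hg hV hVU _ _ _ hp, Pi.star_apply, star_star]
      refine Finset.sum_congr rfl fun n _ => ?_
      rw [Finset.sum_comm, sum_Icc_one_eq_sum_range]
      refine Finset.sum_congr rfl fun i _ => ?_
      rw [sum_Icc_one_eq_sum_range]
      refine Finset.sum_congr rfl fun j _ => ?_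
      simp only [Nat.add_sub_add_right, Nat.add_sub_cancel, iter2, conjCoeff,
        PowerSeries.coeff_map]
      push_cast
      rw [mul_assoc]
      congr 1
      ring

theorem HasExpansionOn.apply_add_left (hT : HasExpansionOn U g C T) (hg : IsKahlerOn U g)
    (hV : IsOpen V) (hVU : V ⊆ U) (k : ℕ) {f f' h : C2 → ℂ} (hf : SmoothOn V f)
    (hf' : SmoothOn V f') (hh : SmoothOn V h) :
    Set.EqOn (C k (f + f') h) (C k f h + C k f' h) V := by
  intro q hq
  obtain ⟨N, -, h2⟩ := hT.expand_range k
  rw [Pi.add_apply, h2 V hV hVU _ h (hf.add hf') hh q hq, h2 V hV hVU _ h hf hh q hq,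
    h2 V hV hVU _ h hf' hh q hq]
  simp only [iter2_add (isDerivationOn_Dop hg hV hVU) _ _ hf hf' hq, Pi.add_apply,
    ← Finset.sum_add_distrib, add_mul, mul_add]

theorem HasExpansionOn.apply_smul_left (hT : HasExpansionOn U g C T) (hg : IsKahlerOn U g)
    (hV : IsOpen V) (hVU : V ⊆ U) (k : ℕ) (c : ℂ) {f h : C2 → ℂ} (hf : SmoothOn V f)
    (hh : SmoothOn V h) :
    Set.EqOn (C k (c • f) h) (c • C k f h) V := by
  intro q hq
  obtain ⟨N, -, h2⟩ := hT.expand_range k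
  rw [Pi.smul_apply, h2 V hV hVU _ h (hf.smul c) hh q hq, h2 V hV hVU _ h hf hh q hq]
  simp only [iter2_smul (isDerivationOn_Dop hg hV hVU) _ _ c hf hq, Pi.smul_apply,
    smul_eq_mul, Finset.mul_sum]
  exact Finset.sum_congr rfl fun n _ => Finset.sum_congr rfl fun i _ =>
    Finset.sum_congr rfl fun j _ => by ring

/-! ### Left normalization and Hermiticity of the coefficients. -/

namespace IsKarabegovProductOn

/-- The constant 1 is the monomial of degree 0, so on the left it sees only T^0, which is 1. -/
theorem one_mul (hC : IsKarabegovProductOn U g C) (hg : IsKahlerOn U g)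
    (hT : HasExpansionOn U g C T) {p : C2} (hV : IsOpen V) (hVU : V ⊆ U) (hp : p ∈ V)
    {f : C2 → ℂ} (hf : SmoothOn V f) (k : ℕ) : C k 1 f p = if k = 0 then f p else 0 := by
  obtain ⟨W, hW, hpW, hWU, Φ, hΦ⟩ := hg.potential p (hVU hp)
  have hΦ' : IsPotentialOn (V ∩ W) g Φ :=
    ⟨hΦ.smooth.mono Set.inter_subset_right, fun q hq => hΦ.eq q hq.2⟩
  have hVW : V ∩ W ⊆ U := Set.inter_subset_left.trans hVU
  have hu := (hΦ'.isDualOn_Dop hg (hV.inter hW) hVW).sub_const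
    fun k => -dz k (fun q => (Φ q : ℂ)) p
  have := hT.apply_divMon (hV.inter hW) hVW hu ⟨hp, hpW⟩ (fun k => by simp) k (n := 0) (i := 0)
    le_rfl (hf.mono Set.inter_subset_left)
  have h0 := hC.coeff_zero_eq_one hg hT (hVU hp)
  simp [divMon_zero, iter2, h0, PowerSeries.coeff_one] at this
  rw [this]

/-- Left multiplication by `∂_l Φ` is `∂_l Φ + ħ ∂_l`. -/
theorem left_normalized (hC : IsKarabegovProductOn U g C) (hg : IsKahlerOn U g)
    (hT : HasExpansionOn U g C T) (hV : IsOpen V) (hVU : V ⊆ U) (hΦ : IsPotentialOn V g Φ)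
    {f : C2 → ℂ} (hf : SmoothOn V f) (l : Fin 2) {p : C2} (hp : p ∈ V) :
    C 0 (dz l fun q => (Φ q : ℂ)) f p = dz l (fun q => (Φ q : ℂ)) p * f p ∧
      C 1 (dz l fun q => (Φ q : ℂ)) f p = dz l f p ∧
      ∀ k, C (k + 2) (dz l fun q => (Φ q : ℂ)) f p = 0 := by
  set w : Fin 2 → C2 → ℂ := fun k => dz k fun q => (Φ q : ℂ) with hw
  have hu := (hΦ.isDualOn_Dop hg hV hVU).sub_const fun k => -w k p
  set u : Fin 2 → C2 → ℂ := fun k => (fun _ => -w k p) + w k with hu_def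
  have hu0 : ∀ k, u k p = 0 := fun k => by simp [hu_def]
  -- Being a monomial of degree one, u l sees one row of T^1 = ħ g, and g_{l m̄} D^m̄ = ∂_l.
  have e1 : ∀ k, C k (u l) f p = (if k = 1 then dz l f p else 0) := by
    intro k
    have e : u l = divMon u (((1 : ℕ) : ℤ) - (l : ℕ)) (l : ℕ) := by
      fin_cases l <;> simp [divMon, divPow_zero, divPow_one]
    rw [e, hT.apply_divMon hV hVU hu hp hu0 k (by omega) hf, Finset.sum_range_succ,
      Finset.sum_range_one]
    have t : ∀ m : Fin 2, PowerSeries.coeff k (T 1 ((l : ℕ) + 1) ((m : ℕ) + 1) p)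
        = if k = 1 then g p l m else 0 := by
      intro m
      rw [hC.coeff_one_eq hg hT (hVU hp) l m, PowerSeries.coeff_mul_C, PowerSeries.coeff_X]
      simp
    have t0 : PowerSeries.coeff k (T (1 : ℕ) ((l : ℕ) + 1) ((0 : ℕ) + 1) p) = _ := t 0
    have t1 : PowerSeries.coeff k (T (1 : ℕ) ((l : ℕ) + 1) ((1 : ℕ) + 1) p) = _ := t 1
    rw [t0, t1]
    split_ifs <;> simp [iter2, dz_eq_sum_DopBar (hg.posDef p (hVU hp))]
  have e3 : ∀ k, C k (w l) f p = C k (u l) f p + w l p * C k 1 f p := by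
    intro k
    have : w l = u l + w l p • 1 := by ext q; simp [hu_def]
    conv_lhs => rw [this]
    rw [hT.apply_add_left hg hV hVU k (hu.smooth l) (SmoothOn.one.smul _) hf hp, Pi.add_apply,
      hT.apply_smul_left hg hV hVU k _ SmoothOn.one hf hp]
    rfl
  refine ⟨?_, ?_, fun k => ?_⟩ <;> rw [e3, e1, hC.one_mul hg hT hV hVU hp hf] <;> simp [hw]

/-- Conjugation exchanges ∂_l̄Φ and ∂_lΦ because Φ is real, so the normalization of the new product
is the left normalization of the old one. Likewise its right unit is the old left unit. -/
theorem conjOp (hC : IsKarabegovProductOn U g C) (hg : IsKahlerOn U g)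
    (hT : HasExpansionOn U g C T) : IsKarabegovProductOn U g (conjOp C) where
  assoc V hV hVU f h w hf hh hw m p hp := by
    have := hC.assoc V hV hVU _ _ _ hw.conj hh.conj hf.conj m p hp
    simp only [KahlerStar.conjOp, Pi.star_apply, star_star, ← star_sum, this]
  mul_one V hV hVU f hf k p hp := by
    have h1 : (star (1 : C2 → ℂ)) = 1 := star_one _
    rw [KahlerStar.conjOp, Pi.star_apply, h1, hC.one_mul hg hT hV hVU hp hf.conj]
    split_ifs <;> simp
  normalized V hV hVU Φ hΦ f hf l p hp := by
    have hφ : star (fun q => (Φ q : ℂ)) = fun q => (Φ q : ℂ) := by ext q; simp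
    have hψ : star (dzbar l fun q => (Φ q : ℂ)) = dz l fun q => (Φ q : ℂ) := by
      rw [← dz_star, hφ]
    obtain ⟨h0, h1, h2⟩ := hC.left_normalized hg hT hV hVU hΦ hf.conj l hp
    refine ⟨?_, ?_, fun k => ?_⟩
    · rw [KahlerStar.conjOp, Pi.star_apply, hψ, h0, ← hψ]; simp
    · rw [KahlerStar.conjOp, Pi.star_apply, hψ, h1, dz_star]; simp
    · rw [KahlerStar.conjOp, Pi.star_apply, hψ, h2]; simp

/-- The coefficient matrices are Hermitian. -/
theorem coeff_hermitian (hC : IsKarabegovProductOn U g C) (hg : IsKahlerOn U g)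
    (hT : HasExpansionOn U g C T) {p : C2} (hp : p ∈ U) (n i j : ℤ) :
    PowerSeries.map (starRingEnd ℂ) (T n j i p) = T n i j p := by
  refine (((hC.conjOp hg hT).satisfiesRecursion hg (hT.conjOp hg) hp).unique
    (hC.satisfiesRecursion hg hT hp) (fun n i j h => ?_) ?_ n i j)
  · rw [hT.outside n i j h p hp, (hT.conjOp hg).outside n i j h p hp]
  · rw [hC.coeff_zero_eq_one hg hT hp,
      (hC.conjOp hg hT).coeff_zero_eq_one hg (hT.conjOp hg) hp]

end IsKarabegovProductOn

end

section

variable {U V : Set C2} {g : C2 → Matrix (Fin 2) (Fin 2) ℂ}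
  {C : ℕ → (C2 → ℂ) → (C2 → ℂ) → C2 → ℂ} {T : ℤ → ℤ → ℤ → C2 → ℂ⟦X⟧}

/-! ### From the formal star product to the operators `C_k` -/

theorem coeff_C_of_ne_zero {R : Type*} [Semiring R] {n : ℕ} (hn : n ≠ 0) (a : R) :
    PowerSeries.coeff n (PowerSeries.C a) = 0 := by
  rw [PowerSeries.coeff_C, if_neg hn]

theorem formalSmoothOn_C {f : C2 → ℂ} (hf : SmoothOn V f) :
    FormalSmoothOn V (PowerSeries.C f) := by
  intro k
  rw [PowerSeries.coeff_C]
  split_ifs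
  · exact hf
  · exact SmoothOn.zero

section

variable (hg : IsKahlerOn U g) (hT : HasExpansionOn U g C T) (hV : IsOpen V) (hVU : V ⊆ U)

include hg hT hV hVU

/-- A constant series has only its ħ^0 coefficient, and C_k vanishes on 0 by the expansion, so the
double sum in `starProd` collapses to a single one. -/
theorem coeff_starProd_C_left {f : C2 → ℂ} {G : (C2 → ℂ)⟦X⟧} (hG : FormalSmoothOn V G) (m : ℕ)
    {q : C2} (hq : q ∈ V) : PowerSeries.coeff m (starProd C (PowerSeries.C f) G) q
      = ∑ x ∈ Finset.HasAntidiagonal.antidiagonal m, C x.1 f (PowerSeries.coeff x.2 G) q := by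
  rw [starProd, PowerSeries.coeff_mk, Finset.sum_apply]
  refine Finset.sum_congr rfl fun x _ => ?_
  rw [Finset.sum_apply, Finset.sum_eq_single (0, x.2)]
  · simp
  · intro y hy hne
    have : y.1 ≠ 0 := by
      rintro h
      exact hne (Prod.ext h (by simpa [h] using Finset.HasAntidiagonal.mem_antidiagonal.1 hy))
    rw [coeff_C_of_ne_zero this, hT.apply_zero_left hg hV hVU _ (hG _) hq]
    rfl
  · intro h
    simp at h

theorem coeff_starProd_C_right {F : (C2 → ℂ)⟦X⟧} {h : C2 → ℂ} (hF : FormalSmoothOn V F) (m : ℕ)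
    {q : C2} (hq : q ∈ V) : PowerSeries.coeff m (starProd C F (PowerSeries.C h)) q
      = ∑ x ∈ Finset.HasAntidiagonal.antidiagonal m, C x.1 (PowerSeries.coeff x.2 F) h q := by
  rw [starProd, PowerSeries.coeff_mk, Finset.sum_apply]
  refine Finset.sum_congr rfl fun x _ => ?_
  rw [Finset.sum_apply, Finset.sum_eq_single (x.2, 0)]
  · simp
  · intro y hy hne
    have : y.2 ≠ 0 := by
      rintro h
      exact hne (Prod.ext (by simpa [h] using Finset.HasAntidiagonal.mem_antidiagonal.1 hy) h)
    rw [coeff_C_of_ne_zero this, hT.apply_zero_right hg hV hVU _ (hF _) hq]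
    rfl
  · intro h
    simp at h

theorem coeff_starProd_C_C {f h : C2 → ℂ} (hf : SmoothOn V f) (hh : SmoothOn V h) (m : ℕ)
    {q : C2} (hq : q ∈ V) :
    PowerSeries.coeff m (starProd C (PowerSeries.C f) (PowerSeries.C h)) q = C m f h q := by
  rw [coeff_starProd_C_left hg hT hV hVU (formalSmoothOn_C hh) m hq,
    Finset.sum_eq_single (m, 0)]
  · simp
  · intro y hy hne
    have : y.2 ≠ 0 := by
      rintro h
      exact hne (Prod.ext (by simpa [h] using Finset.HasAntidiagonal.mem_antidiagonal.1 hy) h)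
    rw [coeff_C_of_ne_zero this, hT.apply_zero_right hg hV hVU _ hf hq]
    rfl
  · intro h
    simp at h

end

theorem isKarabegovProductOn (hg : IsKahlerOn U g) (hT : HasExpansionOn U g C T)
    (hstar : IsStarProductOn U g C) (hnorm : IsKarabegovNormalizedOn U g C) :
    IsKarabegovProductOn U g C where
  assoc V hV hVU f h w hf hh hw m p hp := by
    have e : ∀ {f h : C2 → ℂ}, SmoothOn V f → SmoothOn V h → ∀ k,
        Set.EqOn (PowerSeries.coeff k (starProd C (PowerSeries.C f) (PowerSeries.C h)))
          (C k f h) V := fun hf hh k q hq => coeff_starProd_C_C hg hT hV hVU hf hh k hq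
    have s : ∀ {f h : C2 → ℂ}, SmoothOn V f → SmoothOn V h →
        FormalSmoothOn V (starProd C (PowerSeries.C f) (PowerSeries.C h)) := fun hf hh k =>
      (hT.smoothOn_apply hg hV hVU k hf hh).congr (e hf hh k)
    have := hstar.assoc V hV hVU _ _ _ (formalSmoothOn_C hf) (formalSmoothOn_C hh)
      (formalSmoothOn_C hw) m hp
    rw [coeff_starProd_C_left hg hT hV hVU (s hh hw) m hp,
      coeff_starProd_C_right hg hT hV hVU (s hf hh) m hp] at this
    rw [Finset.sum_congr rfl fun x _ => (hT.apply_congr hg hV hVU x.1 hf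
        (hT.smoothOn_apply hg hV hVU x.2 hh hw) (fun _ _ => rfl) (e hh hw x.2) hp).symm, this]
    exact Finset.sum_congr rfl fun x _ => hT.apply_congr hg hV hVU x.1
        (hT.smoothOn_apply hg hV hVU x.2 hf hh) hw (e hf hh x.2) (fun _ _ => rfl) hp
  mul_one V hV hVU f hf k p hp := by
    have := (hstar.unit V hV hVU _ (formalSmoothOn_C hf)).1 k hp
    rw [← map_one PowerSeries.C, coeff_starProd_C_C hg hT hV hVU hf SmoothOn.one k hp] at this
    rw [this, PowerSeries.coeff_C]
    split_ifs <;> rfl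
  normalized V hV hVU Φ hΦ f hf l p hp := by
    have hψ := (isDerivationOn_dzbar hV l).smooth hΦ.smoothOn
    have h := fun k => hnorm V hV hVU Φ hΦ f hf l k hp
    simp only [coeff_starProd_C_C hg hT hV hVU hf hψ _ hp] at h
    refine ⟨?_, ?_, fun k => ?_⟩
    · simp [h 0]
    · have := h 1
      rw [map_add, coeff_C_of_ne_zero one_ne_zero, zero_add, ← zero_add 1,
        PowerSeries.coeff_succ_X_mul] at this
      simpa using this
    · rw [h, map_add, coeff_C_of_ne_zero (by omega), zero_add, PowerSeries.coeff_succ_X_mul,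
        coeff_C_of_ne_zero (by omega)]
      rfl

/-! ### The matrix identities -/

/-- A column of `Y_n` has at most five nonzero entries. -/
theorem sum_mul_yEntry (n : ℕ) (p : C2) (j : ℕ) (hj : j ≤ n) (τ : ℤ → ℂ⟦X⟧)
    (hτ : ∀ k : ℤ, k < 1 ∨ (n : ℤ) + 1 < k → τ k = 0) :
    ∑ k : Fin (n + 1), τ ((k : ℤ) + 1) * yEntry g n p ((k : ℕ) + 1) (j + 1)
      = PowerSeries.X * ((-((n + 2 - j).choose 2 : ℂ) * curv g 1 0 0 1 p) • τ ((j : ℤ) - 1))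
        + PowerSeries.X *
          ((-(((n : ℂ) - j + 1) * ((j : ℂ) - 1)) * curv g 1 1 0 1 p) • τ (j : ℤ))
        + (((n : ℂ) - 2 * j) • τ ((j : ℤ) + 1)
          + PowerSeries.X * ((((n - j).choose 2 : ℂ) * curv g 0 0 0 0 p
            - (j.choose 2 : ℂ) * curv g 1 1 1 1 p) • τ ((j : ℤ) + 1)))
        + PowerSeries.X *
          ((((j : ℂ) + 1) * ((n : ℂ) - j - 1) * curv g 0 1 0 0 p) • τ ((j : ℤ) + 2))
        + PowerSeries.X * ((((j + 2).choose 2 : ℂ) * curv g 0 1 1 0 p) • τ ((j : ℤ) + 3)) := by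
  -- Allowing s out of range, where τ s = 0, treats the truncated bands at the edges of the matrix
  -- uniformly.
  have single : ∀ (s : ℤ) (a : ℂ⟦X⟧), ∑ k : Fin (n + 1),
      (if (k : ℤ) + 1 = s then τ ((k : ℤ) + 1) * a else 0) = τ s * a := by
    intro s a
    by_cases hs : s < 1 ∨ (n : ℤ) + 1 < s
    · rw [hτ s hs, zero_mul]
      exact Finset.sum_eq_zero fun k _ => if_neg (by have := k.2; omega)
    · rw [Finset.sum_eq_single (⟨(s - 1).toNat, by omega⟩ : Fin (n + 1))]
      · rw [if_pos (by simp; omega)]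
        congr 2
        simp; omega
      · intro k _ hk
        refine if_neg fun h => hk (Fin.ext ?_)
        simp; omega
      · simp
  have split : ∀ k : Fin (n + 1), τ ((k : ℤ) + 1) * yEntry g n p ((k : ℕ) + 1) (j + 1)
      = (if (k : ℤ) + 1 = (j : ℤ) - 1 then τ ((k : ℤ) + 1) * (PowerSeries.X *
          PowerSeries.C (-((n + 3 - (j + 1)).choose 2 : ℂ) * curv g 1 0 0 1 p)) else 0)
        + (if (k : ℤ) + 1 = (j : ℤ) then τ ((k : ℤ) + 1) * (PowerSeries.X * PowerSeries.C
          (-(((n : ℂ) - (j + 1 : ℕ) + 2) * (((j + 1 : ℕ) : ℂ) - 2)) * curv g 1 1 0 1 p)) else 0)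
        + (if (k : ℤ) + 1 = (j : ℤ) + 1 then τ ((k : ℤ) + 1) *
          (PowerSeries.C ((n : ℂ) - 2 * (j + 1 : ℕ) + 2)
          + PowerSeries.X * PowerSeries.C (((n + 1 - (j + 1)).choose 2 : ℂ) * curv g 0 0 0 0 p
          - ((j + 1 - 1).choose 2 : ℂ) * curv g 1 1 1 1 p)) else 0)
        + (if (k : ℤ) + 1 = (j : ℤ) + 2 then τ ((k : ℤ) + 1) * (PowerSeries.X *
          PowerSeries.C (((j + 1 : ℕ) : ℂ) * ((n : ℂ) - (j + 1 : ℕ)) * curv g 0 1 0 0 p)) else 0)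
        + (if (k : ℤ) + 1 = (j : ℤ) + 3 then τ ((k : ℤ) + 1) * (PowerSeries.X *
          PowerSeries.C (((j + 1 + 1).choose 2 : ℂ) * curv g 0 1 1 0 p)) else 0) := by
    intro k
    rw [yEntry]
    split_ifs <;> first | omega | simp
  simp only [split, Finset.sum_add_distrib, single, PowerSeries.smul_eq_C_mul]
  have e1 : n + 3 - (j + 1) = n + 2 - j := by omega
  have e2 : n + 1 - (j + 1) = n - j := by omega
  rw [e1, e2, Nat.add_sub_cancel]
  push_cast
  have a1 : (n : ℂ) - (j + 1) + 2 = n - j + 1 := by ring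
  have a2 : (j : ℂ) + 1 - 2 = j - 1 := by ring
  have a3 : (n : ℂ) - 2 * (j + 1) + 2 = n - 2 * j := by ring
  have a4 : (n : ℂ) - (j + 1) = n - j - 1 := by ring
  rw [a1, a2, a3, a4]
  ring

/-- For the zero-based column j, the recursion is used for l = 0 with exponents (n - 1 - j, j) and
for l = 1 with (n - j, j - 1). Both lead with τ (j + 1), with factors n - j and j; their difference
gives the diagonal n - 2j. -/
theorem SatisfiesRecursion.mul_YMat {p : C2} (h : SatisfiesRecursion g p T)
    (hT : HasExpansionOn U g C T) (hg : IsKahlerOn U g) (hp : p ∈ U) (n : ℕ) :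
    TMat T n p * YMat g n p = (PowerSeries.X : ℂ⟦X⟧) • CMat g T n p := by
  obtain ⟨V, hV, hpV, hVU, Φ, hΦ⟩ := hg.potential p hp
  have outer := fun l c a b => hΦ.curv_symm_outer hg hV hVU l c a b hpV
  have inner := fun l c a b => hΦ.curv_symm_inner hg hV hVU l c a b hpV
  ext1 i j
  have hi := i.2
  have hj := j.2
  set τ : ℤ → ℂ⟦X⟧ := fun j => T n ((i : ℤ) + 1) j p with hτ_def
  have hτ : ∀ k : ℤ, k < 1 ∨ (n : ℤ) + 1 < k → τ k = 0 := fun k hk =>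
    hT.outside _ _ _ (by omega) p hp
  have hout : ∀ a b : ℤ, b < 1 ∨ (n : ℤ) < b → T ((n : ℤ) - 1) a b p = 0 := fun a b hab =>
    hT.outside _ _ _ (by omega) p hp
  have lhs := sum_mul_yEntry (g := g) n p j (by omega) τ hτ
  rw [Matrix.mul_apply]
  simp only [TMat, YMat, Matrix.of_apply, Matrix.smul_apply, CMat, smul_eq_mul]
  refine lhs.trans ?_
  clear lhs
  obtain ⟨i, hi'⟩ := i
  obtain ⟨j, hj'⟩ := j
  simp only at hi hj hτ_def hτ ⊢
  have h0 : ((n : ℂ) - j) • τ (j + 1)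
      + PowerSeries.X * ((((n - j).choose 2 : ℂ) * curv g 0 0 0 0 p) • τ (j + 1)
        + (((n : ℂ) - j - 1) * ((j : ℂ) + 1) * curv g 0 0 1 0 p) • τ (j + 2)
        + (((j + 2).choose 2 : ℂ) * curv g 0 1 1 0 p) • τ (j + 3)
        + ((((n + 1 - j).choose 2 : ℂ) * curv g 0 0 0 1 p) • τ j
        + (((n : ℂ) - j) * (j : ℂ) * curv g 0 0 1 1 p) • τ (j + 1)
        + (((j + 1).choose 2 : ℂ) * curv g 0 1 1 1 p) • τ (j + 2)))
      = PowerSeries.X * (g p 0 0 • T ((n : ℤ) - 1) (i + 1) (j + 1) p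
        + g p 1 0 • T ((n : ℤ) - 1) i (j + 1) p) := by
    rcases Nat.lt_or_ge j n with hjn | hjn
    · obtain ⟨c, rfl⟩ : ∃ c, n = c + j + 1 := ⟨n - 1 - j, by omega⟩
      have e1 : c + j + 1 - j = c + 1 := by omega
      have e2 : c + j + 1 + 1 - j = c + 2 := by omega
      have e3 : ((c + j + 1 : ℕ) : ℤ) - 1 = ((c + j : ℕ) : ℤ) := by push_cast; ring
      have := h 0 c j i (by omega) τ (fun _ => rfl)
      rw [if_pos rfl] at this
      rw [e1, e2, e3, ← this]
      push_cast
      have a1 : (c : ℂ) + j + 1 - j = c + 1 := by ring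
      have a2 : (c : ℂ) + 1 - 1 = c := by ring
      rw [a1, a2]
    -- The exponent n - 1 - j would be -1; all terms on both sides vanish instead.
    · obtain rfl : j = n := by omega
      have e2 : j + 1 - j = 1 := by omega
      rw [hτ (j + 2) (by omega), hτ (j + 3) (by omega), hout _ _ (by omega), hout _ _ (by omega),
        e2]
      simp
  have h1 : (j : ℂ) • τ (j + 1)
      + PowerSeries.X * ((((n + 1 - j).choose 2 : ℂ) * curv g 1 0 0 0 p) • τ j
        + (((n : ℂ) - j) * (j : ℂ) * curv g 1 0 1 0 p) • τ (j + 1)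
        + (((j + 1).choose 2 : ℂ) * curv g 1 1 1 0 p) • τ (j + 2)
        + ((((n + 2 - j).choose 2 : ℂ) * curv g 1 0 0 1 p) • τ (j - 1)
        + (((n : ℂ) - j + 1) * ((j : ℂ) - 1) * curv g 1 0 1 1 p) • τ j
        + ((j.choose 2 : ℂ) * curv g 1 1 1 1 p) • τ (j + 1)))
      = PowerSeries.X * (g p 0 1 • T ((n : ℤ) - 1) (i + 1) j p
        + g p 1 1 • T ((n : ℤ) - 1) i j p) := by
    -- For j = 0 the exponent j - 1 would be -1, and again every term vanishes.
    rcases j with _ | j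
    · rw [hτ ((0 : ℕ) : ℤ) (by simp), hτ (((0 : ℕ) : ℤ) - 1) (by simp), hout _ _ (by simp),
        hout _ _ (by simp)]
      simp
    · obtain ⟨c, rfl⟩ : ∃ c, n = c + j + 1 := ⟨n - 1 - j, by omega⟩
      have e1 : c + j + 1 + 1 - (j + 1) = c + 1 := by omega
      have e2 : c + j + 1 + 2 - (j + 1) = c + 2 := by omega
      have e3 : ((c + j + 1 : ℕ) : ℤ) - 1 = ((c + j : ℕ) : ℤ) := by push_cast; ring
      have := h 1 c j i (by omega) τ (fun _ => rfl)
      rw [if_neg one_ne_zero] at this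
      have b1 : ((j + 1 : ℕ) : ℤ) = (j : ℤ) + 1 := by push_cast; rfl
      have b2 : (j : ℤ) + 1 + 1 = j + 2 := by ring
      have b3 : (j : ℤ) + 1 + 2 = j + 3 := by ring
      have b4 : (j : ℤ) + 1 - 1 = j := by ring
      rw [e1, e2, e3, b1, b2, b3, b4, ← this]
      push_cast
      have a1 : (c : ℂ) + j + 1 - (j + 1) = c := by ring
      have a2 : (j : ℂ) + 1 - 1 = j := by ring
      rw [a1, a2]
  -- The symmetries identify the components R with l = 1, b = 0 with those with l = 0, b = 1. Their
  -- binomial factors already agree, so these terms cancel in h0 - h1 and the five bands of `YMat`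
  -- remain.
  rw [outer 1 0 0 0, outer 1 0 1 0, outer 1 1 1 0, inner 1 0 1 1] at h1
  rw [inner 0 0 1 0] at h0
  simp only [Fin.sum_univ_two, gLow, Matrix.fromBlocks_apply₂₁, Matrix.transpose_apply,
    PowerSeries.smul_eq_C_mul, map_mul, map_neg, map_sub, map_add, map_one, Fin.isValue,
    zero_ne_one, if_true, if_false, sub_zero, add_sub_cancel_right] at h0 h1 ⊢
  simp only [map_natCast, map_ofNat] at h0 h1 ⊢
  linear_combination h0 - h1

end

theorem dagger_mul {m : ℕ} (M N : Matrix (Fin m) (Fin m) ℂ⟦X⟧) :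
    dagger (M * N) = dagger N * dagger M := by
  rw [dagger, Matrix.transpose_mul, Matrix.map_mul]
  rfl

theorem dagger_X_smul {m : ℕ} (M : Matrix (Fin m) (Fin m) ℂ⟦X⟧) :
    dagger ((PowerSeries.X : ℂ⟦X⟧) • M) = (PowerSeries.X : ℂ⟦X⟧) • dagger M := by
  ext1 i j
  simp [dagger]

end KahlerStar

end

theorem mainTheorem3
    (U : Set KahlerStar.C2) (hU : IsOpen U)
    (g : KahlerStar.C2 → Matrix (Fin 2) (Fin 2) ℂ)
    (hg : KahlerStar.IsKahlerOn U g)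
    (hsymm : KahlerStar.IsLocallySymmetricOn U g)
    (C : ℕ → (KahlerStar.C2 → ℂ) → (KahlerStar.C2 → ℂ) → KahlerStar.C2 → ℂ)
    (hstar : KahlerStar.IsStarProductOn U g C)
    (hsep : KahlerStar.SeparatesVariablesOn U C)
    (hnorm : KahlerStar.IsKarabegovNormalizedOn U g C)
    (T : ℤ → ℤ → ℤ → KahlerStar.C2 → PowerSeries ℂ)
    (hT : KahlerStar.HasExpansionOn U g C T)
    (n : ℕ) (p : KahlerStar.C2) (hp : p ∈ U) :
    KahlerStar.TMat T n p * KahlerStar.YMat g n p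
        = (PowerSeries.X : PowerSeries ℂ) • KahlerStar.CMat g T n p ∧
      KahlerStar.dagger (KahlerStar.YMat g n p) * KahlerStar.TMat T n p
        = (PowerSeries.X : PowerSeries ℂ) • KahlerStar.dagger (KahlerStar.CMat g T n p) := by
  have hC := KahlerStar.isKarabegovProductOn hg hT hstar hnorm
  have h1 := (hC.satisfiesRecursion hg hT hp).mul_YMat hT hg hp n
  refine ⟨h1, ?_⟩
  -- Hermiticity turns the adjoint Y† T† = ħ C'† of the first identity into the second.
  have hdag : KahlerStar.dagger (KahlerStar.TMat T n p) = KahlerStar.TMat T n p := by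
    ext1 i j
    exact hC.coeff_hermitian hg hT hp n _ _
  rw [← KahlerStar.dagger_X_smul, ← h1, KahlerStar.dagger_mul, hdag]
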